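/- Let $n\ge 0$ and let $\mathcal F=\{f_i:I_i\to\mathbb R\}_{i=1}^n$ be a system of continuous strictly monotone functions, where each $I_i=[c_i^\ell,c_i^r]$ is a compact interval with $c_i^\ell<c_i^r$. For a word $g=a_{i_1}\cdots a_{i_m}$ in the free monoid on $a_1,\dots,a_n$ put $|g|=m$, $f_g=f_{i_m}\circ\cdots\circ f_{i_1}$, defined on its natural domain $\mathrm{Dom}(f_g)$ (with $f_e=\mathrm{id}_{\mathbb R}$ for the empty word $e$), and let $\sigma(f_g)=\pm1$ be the product of the orientations of the letters ($+1$ for increasing, $-1$ for decreasing). Let $\mathring S$ be the set of words $g$ with $\mathrm{int}(\mathrm{Dom}(f_g))\ne\emptyset$. Let $c_1<\dots<c_{l+1}$ be the distinct endpoints of the $I_i$ (the turning points); they cut $\mathbb R$ into closed intervals $P_0,\dots,P_{l+1}$, numbered from left to right. The address $D(x)$ is the formal vector $P_j$ if $x\in P_j$ is not a turning point, and $\tfrac12(P_{i-1}+P_i)$ if $x=c_i$. The invariant coordinate of $x$ is $$\theta(x)=\sum_{g\in\mathring S,\ x\in \mathrm{Dom}(f_g)}\sigma(f_g)\,D(f_g(x))\,t^{|g|}=\sum_{j=0}^{l+1}\theta_j(x)P_j,\qquad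 \theta_j(x)\in\mathbb Q[[t]],$$ and $\theta(x^\pm)$ are its one-sided limits (each coefficient is eventually constant). The kneading matrix $(N_{i,j})_{1\le i\le l+1,\,0\le j\le l+1}$ has rows $\theta(c_i^+)-\theta(c_i^-)=\sum_j N_{i,j}P_j$. Let $D_j$ be the determinant of the kneading matrix with the column of index $j$ deleted, and $e_j(t)=1-\sum_{i:\,P_j\subset I_i}\sigma(f_{a_i})\,t$. The kneading determinant is the power series $D=(-1)^jD_j/e_j\in\mathbb Q[[t]]$, which does not depend on $j$. Let $\ell(m)=\#\{g\in\mathring S:|g|=m\}$, $\ell'_{c}(m)=\#\{g\in\mathring S: |g|=m,\ c\in\mathrm{Dom}(f_g)\cap\partial\,\mathrm{Dom}(f_g)\}$, $L=\sum_{m\ge1}\ell(m)t^{m-1}$, and $$s=\limsup_{m\to\infty}\ell(m)^{1/m},\qquad s_0=\max_{1\le i\le l+1}\ \limsup_{m\to\infty}\ell'_{c_i}(m)^{1/m}.$$ Suppose $s_0<s$. Then the series $L$ converges on $|t|<1/s$ and extends to a meromorphic function on $\{t\in\mathbb C:|t|<1/s_0\}$ (the whole plane if $s_0=0$) with a pole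 at $t=1/s$. Moreover the power series $D$ converges on $\{|t|<1/s_0\}$, vanishes at $t=1/s$, and has no zero in the open disk $|t|<1/s$. (For $n=0$ there are no turning points, $s=0$, the maximum $s_0$ is read as $0$, and the hypothesis fails.) -/

import Mathlib

open Set Filter Topology
open scoped Classical

noncomputable section

/-- A system of `n` continuous strictly monotone functions `f i : [left i, right i] → ℝ` on
nondegenerate compact intervals. Only the values of `map i` on `[left i, right i]` are ever used. -/
structure IntervalSystem (n : ℕ) where
  left : Fin n → ℝ
  right : Fin n → ℝ
  left_lt_right : ∀ i, left i < right i
  map : Fin n → ℝ → ℝ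
  continuousOn_map : ∀ i, ContinuousOn (map i) (Icc (left i) (right i))
  strictMonotone_map : ∀ i, StrictMonoOn (map i) (Icc (left i) (right i)) ∨
    StrictAntiOn (map i) (Icc (left i) (right i))

namespace IntervalSystem

variable {n : ℕ} (F : IntervalSystem n)

/-- The domain `[left i, right i]` of the `i`-th function. -/
def I (i : Fin n) : Set ℝ := Icc (F.left i) (F.right i)

/-- Domain of `f_g`, for a word `g` in the free monoid `S` on the letters `Fin n`. The empty word
gives the identity of `ℝ`, and `f_{gh} = f_h ∘ f_g`, i.e. the first letter acts first. -/
def dom : List (Fin n) → Set ℝ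
  | [] => univ
  | i :: g => {x | x ∈ F.I i ∧ F.map i x ∈ dom g}

/-- The value `f_g x` (meaningful for `x ∈ F.dom g`). -/
def app : List (Fin n) → ℝ → ℝ
  | [], x => x
  | i :: g, x => app g (F.map i x)

/-- The sign of the `i`-th function: `1` if increasing, `-1` if decreasing. -/
def letterSign (i : Fin n) : ℚ := if StrictMonoOn (F.map i) (F.I i) then 1 else -1

/-- The sign `σ(f_g)`, multiplicative in `g`. -/
def sign (g : List (Fin n)) : ℚ := (g.map F.letterSign).prod

/-- The words `g` of length `m` with `int (Dom f_g) ≠ ∅`. -/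
def words (m : ℕ) : Finset (List (Fin n)) :=
  {g ∈ (List.finite_length_eq (Fin n) m).toFinset | (interior (F.dom g)).Nonempty}

/-- `ℓ(m)`. -/
def lap (m : ℕ) : ℕ := (F.words m).card

/-- `ℓ'_x(m)`: the number of words `g` of length `m` with `int (Dom f_g) ≠ ∅`, `x ∈ Dom f_g` and
`x ∈ ∂ Dom f_g`. -/
def lapBdry (x : ℝ) (m : ℕ) : ℕ :=
  {g ∈ F.words m | x ∈ F.dom g ∧ x ∈ frontier (F.dom g)}.card

/-- The finite set of turning points: all endpoints of the domains. -/
def turningPoints : Finset ℝ := Finset.univ.image F.left ∪ Finset.univ.image F.right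

/-- The number of (distinct) turning points. -/
def numTP : ℕ := F.turningPoints.card

/-- The turning points, listed in increasing order, indexed from `0`. -/
def tp (i : Fin F.numTP) : ℝ := F.turningPoints.orderEmbOfFin rfl i

/-- `s = limsup ℓ(m)^{1/m}`. -/
def growth : ℝ := limsup (fun m : ℕ => (F.lap m : ℝ) ^ (1 / (m : ℝ))) atTop

/-- `s₀`, the maximum over the turning points `c` of `limsup ℓ'_c(m)^{1/m}`. -/
def growthBdry : ℝ :=
  ⨆ i : Fin F.numTP, limsup (fun m : ℕ => (F.lapBdry (F.tp i) m : ℝ) ^ (1 / (m : ℝ))) atTop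

/-- The series `L = ∑_{m ≥ 1} ℓ(m) t^{m-1}`. -/
def lapSeries : PowerSeries ℚ := PowerSeries.mk fun m => (F.lap (m + 1) : ℚ)

/-- The closed pieces `P 0, …, P numTP` into which the turning points cut the line, from left to
right: exactly the turning points with index `< j` lie (weakly) to the left of `P j`. -/
def P (j : Fin (F.numTP + 1)) : Set ℝ :=
  {x | ∀ i : Fin F.numTP, (i.castSucc < j → F.tp i ≤ x) ∧ (j ≤ i.castSucc → x ≤ F.tp i)}

/-- The coefficient at the formal vector `P j` of the address `D(x)`. A point that is not turning
lies in exactly one piece, and the address is that piece; the `i`-th turning point lies in exactly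
the two pieces `P i` and `P (i + 1)`, and its address is `(P i + P (i + 1)) / 2`. -/
def address (x : ℝ) (j : Fin (F.numTP + 1)) : ℚ :=
  if x ∈ F.P j then (if x ∈ F.turningPoints then 1 / 2 else 1) else 0

/-- The `P j`-component `θ_j(x)` of the invariant coordinate
`θ(x) = ∑ σ(f_g) D(f_g x) t^{|g|}`, the sum over the words `g` with `x ∈ Dom f_g` and
`int (Dom f_g) ≠ ∅`. -/
def theta (x : ℝ) (j : Fin (F.numTP + 1)) : PowerSeries ℚ :=
  PowerSeries.mk fun m =>
    ∑ g ∈ F.words m with x ∈ F.dom g, F.sign g * F.address (F.app g x) j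

/-- The right limit `θ_j(x⁺)`, coefficientwise for the discrete topology on `ℚ`
(every coefficient is constant on some interval `(x, x + δ)`). -/
def thetaRight (x : ℝ) (j : Fin (F.numTP + 1)) : PowerSeries ℚ :=
  PowerSeries.mk fun m =>
    letI : TopologicalSpace ℚ := ⊥
    limUnder (𝓝[>] x) fun y => PowerSeries.coeff m (F.theta y j)

/-- The left limit `θ_j(x⁻)`. -/
def thetaLeft (x : ℝ) (j : Fin (F.numTP + 1)) : PowerSeries ℚ :=
  PowerSeries.mk fun m =>
    letI : TopologicalSpace ℚ := ⊥
    limUnder (𝓝[<] x) fun y => PowerSeries.coeff m (F.theta y j)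

/-- The kneading matrix: its `i`-th row is the kneading increment `θ(c_i⁺) - θ(c_i⁻)`. -/
def kneadingMatrix : Matrix (Fin F.numTP) (Fin (F.numTP + 1)) (PowerSeries ℚ) :=
  Matrix.of fun i j => F.thetaRight (F.tp i) j - F.thetaLeft (F.tp i) j

/-- `e_j(t) = 1 - ∑ σ(f_i) t`, the sum over the `i` with `P j ⊆ Dom f_i`. -/
def e (j : Fin (F.numTP + 1)) : PowerSeries ℚ :=
  1 - ∑ i : Fin n with F.P j ⊆ F.I i, PowerSeries.C (F.letterSign i) * PowerSeries.X

/-- The kneading determinant computed by deleting the `j`-th column of the kneading matrix: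
`(-1)^j e_j⁻¹ det [Γ_0, …, Γ_{j-1}, Γ_{j+1}, …]`. It does not depend on `j`. -/
def kneadingDet (j : Fin (F.numTP + 1)) : PowerSeries ℚ :=
  (-1) ^ (j : ℕ) * (F.e j)⁻¹ * (F.kneadingMatrix.submatrix id j.succAbove).det

end IntervalSystem

/-- The power series `A` converges (absolutely) at `t`, with sum `z`. -/
def PowerSeries.HasValueAt (A : PowerSeries ℚ) (t z : ℂ) : Prop :=
  HasSum (fun m : ℕ => ((PowerSeries.coeff m A : ℚ) : ℂ) * t ^ m) z

end

/-!
# Kneading determinant and growth of a system of interval maps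

The argument is that of Milnor and Thurston. Along a one-sided germ `l` of the line the invariant
coordinate `θ(l)` is well defined, and splitting off the first letter of a word gives the renewal
equation `thetaGerm_eq`. It has two consequences.

* `∑ j, θ_j(l) e_j = 1` for every germ (`sum_thetaGerm_mul_e`), so the vector `e` lies in the
  kernel of the kneading matrix `N`, and `(-1)^j e_j⁻¹ D_j` does not depend on `j` (`kneadingDet_eq`). As
  the leftmost piece is unbounded, `e_0 = 1` and `D` is the determinant of the square matrix `N'`
  obtained from `N` by deleting the first column.
* At a point that is not turning, the jump `θ(z⁺) - θ(z⁻)` is transported by the letters, hence the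
  jump at any `z` is `∑ t^{|h|} N_k` over the words `h` which lead `z` for the first time to a
  turning point `c_k` (`coeff_jump_eq`, from `eq_sum_hit_mul`). Since `θ` is a step function in each
  degree, `θ(l) = P_0 + ∑ k, Y_k(l) N_k`, where `Y_k(l)` counts the first hits of `c_k` from points
  left of `l` (`thetaGerm_eq_add_sum`). Inserting this in the renewal equation at the germs `c_j⁺`
  yields an explicit inverse `hitMatrix` of `N'`.

The endpoints of the domains of words obey the same recursion as the jumps, so that counting each
domain by its two endpoints gives `2 L = ∑ k, Y_k(∞) t⁻¹ ℓ'_{c_k}(t)` (`two_mul_lapSeries`). The row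
`Y(∞)` is the last row of `hitMatrix`; by Cramer's rule `2 D L = ∑ k, adj(N')_k t⁻¹ ℓ'_{c_k}(t)`.

The coefficients of `N` are bounded by the numbers `ℓ'` (`abs_coeff_jump_le`), those of `Y` by the
numbers `ℓ` (`coeff_hitSeries_le`). So `D` and the right-hand side of the last identity converge for
`|t| < 1/s₀`, whence the meromorphic extension of `L`, while `hitMatrix` converges for `|t| < 1/s`,
where therefore `D · det hitMatrix = 1` excludes zeros of `D`. Finally `ℓ` is submultiplicative, so
`ℓ(m) ≥ s^m`, and `L` is unbounded as `t` increases to `1/s`: there is a pole, which only a zero of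
`D` can cause.
-/

/-! ### Domains of words and the first letter -/

namespace IntervalSystem

variable {n : ℕ} (F : IntervalSystem n)

lemma injOn_map (i : Fin n) : InjOn (F.map i) (F.I i) :=
  (F.strictMonotone_map i).elim StrictMonoOn.injOn StrictAntiOn.injOn

lemma ordConnected_dom (g : List (Fin n)) : (F.dom g).OrdConnected := by
  induction g with
  | nil => exact ordConnected_univ
  | cons i g ih =>
    refine ⟨fun x hx y hy z hz => ?_⟩
    have hzI : z ∈ F.I i := ⟨hx.1.1.trans hz.1, hz.2.trans hy.1.2⟩
    refine ⟨hzI, ?_⟩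
    rcases F.strictMonotone_map i with h | h
    · exact ih.out hx.2 hy.2 ⟨h.monotoneOn hx.1 hzI hz.1, h.monotoneOn hzI hy.1 hz.2⟩
    · exact ih.out hy.2 hx.2 ⟨h.antitoneOn hzI hy.1 hz.2, h.antitoneOn hx.1 hzI hz.1⟩

lemma isClosed_dom (g : List (Fin n)) : IsClosed (F.dom g) := by
  induction g with
  | nil => exact isClosed_univ
  | cons i g ih => exact (F.continuousOn_map i).preimage_isClosed_of_isClosed isClosed_Icc ih

lemma interior_dom_nonempty_iff (g : List (Fin n)) :
    (interior (F.dom g)).Nonempty ↔ (F.dom g).Nontrivial := by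
  constructor
  · rintro ⟨x, hx⟩
    exact (infinite_of_mem_nhds x (mem_interior_iff_mem_nhds.1 hx)).nontrivial
  · intro h
    obtain ⟨x, hx, y, hy, hxy⟩ := h.exists_lt
    obtain ⟨z, hz⟩ := nonempty_Ioo.2 hxy
    exact ⟨z, interior_mono ((F.ordConnected_dom g).out hx hy)
      (by rw [interior_Icc]; exact hz)⟩

/-- A letter is an open map on the interior of its domain. -/
lemma image_mem_nhds {i : Fin n} {z : ℝ} (hz : z ∈ Ioo (F.left i) (F.right i)) {U : Set ℝ}
    (hU : U ∈ 𝓝 z) : F.map i '' U ∈ 𝓝 (F.map i z) := by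
  obtain ⟨u, v, huv, hsub⟩ :=
    mem_nhds_iff_exists_Ioo_subset.1 (inter_mem hU (Ioo_mem_nhds hz.1 hz.2))
  obtain ⟨u', hu'⟩ := exists_between huv.1
  obtain ⟨v', hv'⟩ := exists_between huv.2
  have hUV : Icc u' v' ⊆ U ∩ Ioo (F.left i) (F.right i) := fun x hx =>
    hsub ⟨hu'.1.trans_le hx.1, hx.2.trans_lt hv'.2⟩
  have huv' : u' ≤ v' := (hu'.2.trans hv'.1).le
  have hI : ∀ x ∈ Icc u' v', x ∈ Icc (F.left i) (F.right i) := fun x hx =>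
    Ioo_subset_Icc_self (hUV hx).2
  have hc : ContinuousOn (F.map i) (Icc u' v') := (F.continuousOn_map i).mono hI
  have hzI : z ∈ Icc u' v' := ⟨hu'.2.le, hv'.1.le⟩
  have hu : u' ∈ Icc u' v' := left_mem_Icc.2 huv'
  have hv : v' ∈ Icc u' v' := right_mem_Icc.2 huv'
  rcases F.strictMonotone_map i with h | h
  · refine mem_of_superset (Icc_mem_nhds (h (hI _ hu) (hI _ hzI) hu'.2)
      (h (hI _ hzI) (hI _ hv) hv'.1)) ((intermediate_value_Icc huv' hc).trans ?_)
    exact image_mono fun x hx => (hUV hx).1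
  · refine mem_of_superset (Icc_mem_nhds (h (hI _ hzI) (hI _ hv) hv'.1)
      (h (hI _ hu) (hI _ hzI) hu'.2)) ((intermediate_value_Icc' huv' hc).trans ?_)
    exact image_mono fun x hx => (hUV hx).1

lemma nontrivial_dom_of_cons {i : Fin n} {g : List (Fin n)} (h : (F.dom (i :: g)).Nontrivial) :
    (F.dom g).Nontrivial := by
  obtain ⟨x, hx, y, hy, hxy⟩ := h
  exact ⟨_, hx.2, _, hy.2, fun e => hxy (F.injOn_map i hx.1 hy.1 e)⟩

/-- A letter with `z` in the interior of its domain preserves nondegeneracy of the domains of words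
defined at the image of `z`. -/
lemma nontrivial_dom_cons_iff {i : Fin n} {z : ℝ} (hz : z ∈ Ioo (F.left i) (F.right i))
    {g : List (Fin n)} (hg : F.map i z ∈ F.dom g) :
    (F.dom (i :: g)).Nontrivial ↔ (F.dom g).Nontrivial := by
  refine ⟨F.nontrivial_dom_of_cons, fun h => ?_⟩
  obtain ⟨y, hy, hne⟩ := h.exists_ne (F.map i z)
  have hV : F.map i '' F.I i ∈ 𝓝 (F.map i z) := F.image_mem_nhds hz (Icc_mem_nhds hz.1 hz.2)
  -- a point of the image of the letter strictly between `F.map i z` and `y`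
  obtain ⟨w, ⟨x, hx, rfl⟩, hw, hwne⟩ :
      ∃ w ∈ F.map i '' F.I i, w ∈ F.dom g ∧ w ≠ F.map i z := by
    rcases lt_or_gt_of_ne hne with hlt | hlt
    · obtain ⟨w, hw1, hw2⟩ := Filter.nonempty_of_mem (inter_mem (mem_nhdsWithin_of_mem_nhds hV)
        (Ico_mem_nhdsLT hlt))
      exact ⟨w, hw1, (F.ordConnected_dom g).out hy hg ⟨hw2.1, hw2.2.le⟩, hw2.2.ne⟩
    · obtain ⟨w, hw1, hw2⟩ := Filter.nonempty_of_mem (inter_mem (mem_nhdsWithin_of_mem_nhds hV)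
        (Ioc_mem_nhdsGT hlt))
      exact ⟨w, hw1, (F.ordConnected_dom g).out hg hy ⟨hw2.1.le, hw2.2⟩, hw2.1.ne'⟩
  exact ⟨z, ⟨Ioo_subset_Icc_self hz, hg⟩, x, ⟨hx, hw⟩, fun e => hwne (by rw [e])⟩

lemma mem_interior_dom_cons_iff {i : Fin n} {z : ℝ} (hz : z ∈ Ioo (F.left i) (F.right i))
    {g : List (Fin n)} :
    z ∈ interior (F.dom (i :: g)) ↔ F.map i z ∈ interior (F.dom g) := by
  have hI : Icc (F.left i) (F.right i) ∈ 𝓝 z := Icc_mem_nhds hz.1 hz.2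
  rw [mem_interior_iff_mem_nhds, mem_interior_iff_mem_nhds]
  constructor
  · intro h
    refine mem_of_superset (F.image_mem_nhds hz h) ?_
    rintro _ ⟨x, hx, rfl⟩
    exact hx.2
  · intro h
    exact inter_mem hI (((F.continuousOn_map i).continuousAt hI) h)

lemma mem_frontier_dom_iff {z : ℝ} {g : List (Fin n)} :
    z ∈ frontier (F.dom g) ↔ z ∈ F.dom g ∧ z ∉ interior (F.dom g) := by
  rw [(F.isClosed_dom g).frontier_eq]; rfl

lemma mem_frontier_dom_cons_iff {i : Fin n} {z : ℝ} (hz : z ∈ Ioo (F.left i) (F.right i))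
    {g : List (Fin n)} :
    z ∈ frontier (F.dom (i :: g)) ↔ F.map i z ∈ frontier (F.dom g) := by
  rw [mem_frontier_dom_iff, mem_frontier_dom_iff, F.mem_interior_dom_cons_iff hz]
  exact and_congr_left fun _ => ⟨fun h => h.2, fun h => ⟨Ioo_subset_Icc_self hz, h⟩⟩

/-- All words of a given length. -/
noncomputable def wordsOfLength (n m : ℕ) : Finset (List (Fin n)) :=
  (List.finite_length_eq (Fin n) m).toFinset

@[simp] lemma mem_wordsOfLength {m : ℕ} {g : List (Fin n)} :
    g ∈ wordsOfLength n m ↔ g.length = m := by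
  simp [wordsOfLength]

lemma sum_wordsOfLength_succ {M : Type*} [AddCommMonoid M] (m : ℕ) (φ : List (Fin n) → M) :
    ∑ g ∈ wordsOfLength n (m + 1), φ g = ∑ i, ∑ g ∈ wordsOfLength n m, φ (i :: g) := by
  rw [← Finset.sum_product']
  symm
  refine Finset.sum_bij (fun p _ => p.1 :: p.2) ?_ ?_ ?_ ?_
  · simp
  · rintro ⟨i, g⟩ _ ⟨i', g'⟩ _ h
    simpa using h
  · intro g hg
    cases g with
    | nil => simp at hg
    | cons i g => exact ⟨(i, g), by simpa using hg, rfl⟩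
  · simp

lemma wordsOfLength_zero : wordsOfLength n 0 = {[]} := by
  ext g; simp

lemma card_wordsOfLength (m : ℕ) : (wordsOfLength n m).card = n ^ m := by
  induction m with
  | zero => simp [wordsOfLength_zero]
  | succ m ih =>
    rw [Finset.card_eq_sum_ones, sum_wordsOfLength_succ]
    simp [ih, pow_succ']

lemma words_eq (m : ℕ) : F.words m = {g ∈ wordsOfLength n m | (F.dom g).Nontrivial} := by
  simp only [words, wordsOfLength, interior_dom_nonempty_iff]

lemma mem_words {m : ℕ} {g : List (Fin n)} :
    g ∈ F.words m ↔ g.length = m ∧ (F.dom g).Nontrivial := by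
  simp [words_eq]

lemma coeff_theta (x : ℝ) (j : Fin (F.numTP + 1)) (m : ℕ) :
    PowerSeries.coeff m (F.theta x j) = ∑ g ∈ wordsOfLength n m,
      if (F.dom g).Nontrivial ∧ x ∈ F.dom g then F.sign g * F.address (F.app g x) j else 0 := by
  rw [theta, PowerSeries.coeff_mk, words_eq, Finset.filter_filter, Finset.sum_filter]

lemma lapBdry_eq_sum (x : ℝ) (m : ℕ) :
    F.lapBdry x m = ∑ g ∈ wordsOfLength n m,
      if (F.dom g).Nontrivial ∧ x ∈ frontier (F.dom g) then 1 else 0 := by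
  rw [lapBdry, words_eq, Finset.filter_filter, Finset.card_filter]
  refine Finset.sum_congr rfl fun g _ => ?_
  congr 1
  exact propext (and_congr_right fun _ => ⟨fun h => h.2, fun h => ⟨(F.mem_frontier_dom_iff.1 h).1, h⟩⟩)

lemma left_mem_turningPoints (i : Fin n) : F.left i ∈ F.turningPoints := by
  simp [turningPoints]

lemma right_mem_turningPoints (i : Fin n) : F.right i ∈ F.turningPoints := by
  simp [turningPoints]

lemma mem_Ioo_of_mem_I {i : Fin n} {y : ℝ} (hy : y ∉ F.turningPoints) (h : y ∈ F.I i) :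
    y ∈ Ioo (F.left i) (F.right i) :=
  ⟨lt_of_le_of_ne h.1 fun e => hy (e ▸ F.left_mem_turningPoints i),
    lt_of_le_of_ne h.2 fun e => hy (e ▸ F.right_mem_turningPoints i)⟩

lemma coeff_zero_theta (x : ℝ) (j : Fin (F.numTP + 1)) :
    PowerSeries.coeff 0 (F.theta x j) = F.address x j := by
  rw [coeff_theta, wordsOfLength_zero]
  simp [dom, app, sign, Set.nontrivial_univ (α := ℝ)]

/-- At a point that is not turning, `θ` satisfies the renewal equation obtained by splitting off
the first letter of a word. -/
lemma coeff_succ_theta {y : ℝ} (hy : y ∉ F.turningPoints) (j : Fin (F.numTP + 1)) (m : ℕ) :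
    PowerSeries.coeff (m + 1) (F.theta y j) =
      ∑ i with y ∈ F.I i, F.letterSign i * PowerSeries.coeff m (F.theta (F.map i y) j) := by
  rw [coeff_theta, sum_wordsOfLength_succ, Finset.sum_filter]
  refine Finset.sum_congr rfl fun i _ => ?_
  split_ifs with h
  · rw [coeff_theta, Finset.mul_sum]
    refine Finset.sum_congr rfl fun g _ => ?_
    have key : ((F.dom (i :: g)).Nontrivial ∧ y ∈ F.dom (i :: g)) ↔
        ((F.dom g).Nontrivial ∧ F.map i y ∈ F.dom g) :=
      ⟨fun ⟨h1, h2⟩ => ⟨F.nontrivial_dom_of_cons h1, h2.2⟩, fun ⟨h1, h2⟩ =>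
        ⟨(F.nontrivial_dom_cons_iff (F.mem_Ioo_of_mem_I hy h) h2).2 h1, h, h2⟩⟩
    simp only [key, mul_ite, mul_zero]
    congr 1
    simp [sign, app, mul_assoc]
  · exact Finset.sum_eq_zero fun g _ => if_neg fun hh => h hh.2.1

/-- The number of words of length `m + 1` with first letter `i` whose domain is nondegenerate and
contains `z`. It is of interest when `z` is an endpoint of the domain of the letter `i`. -/
noncomputable def edgeCount (i : Fin n) (z : ℝ) (m : ℕ) : ℕ :=
  {g ∈ wordsOfLength n m | (F.dom (i :: g)).Nontrivial ∧ z ∈ F.dom (i :: g)}.card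

lemma lapBdry_zero (z : ℝ) : F.lapBdry z 0 = 0 := by
  rw [lapBdry_eq_sum, wordsOfLength_zero]
  simp [dom]

/-- If `z` is an endpoint of the domain of a letter, it is an endpoint of the domain of every word
starting with that letter and defined at `z`; letters with `z` in the interior of their domain map
endpoints to endpoints. -/
lemma lapBdry_succ (z : ℝ) (m : ℕ) :
    F.lapBdry z (m + 1) = ∑ i, if z ∈ Ioo (F.left i) (F.right i) then F.lapBdry (F.map i z) m
      else if z ∈ F.I i then F.edgeCount i z m else 0 := by
  rw [lapBdry_eq_sum, sum_wordsOfLength_succ]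
  refine Finset.sum_congr rfl fun i _ => ?_
  split_ifs with h h'
  · rw [lapBdry_eq_sum]
    refine Finset.sum_congr rfl fun g _ => ?_
    congr 1
    rw [F.mem_frontier_dom_cons_iff h, eq_iff_iff]
    exact ⟨fun ⟨h1, h2⟩ => ⟨F.nontrivial_dom_of_cons h1, h2⟩, fun ⟨h1, h2⟩ =>
      ⟨(F.nontrivial_dom_cons_iff h (F.mem_frontier_dom_iff.1 h2).1).2 h1, h2⟩⟩
  · rw [edgeCount, Finset.card_filter]
    refine Finset.sum_congr rfl fun g _ => ?_
    congr 1
    rw [mem_frontier_dom_iff, eq_iff_iff]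
    refine and_congr_right fun _ => and_iff_left fun hz => h ?_
    have : z ∈ interior (F.I i) := interior_mono (fun x hx => hx.1) hz
    rwa [I, interior_Icc] at this
  · exact Finset.sum_eq_zero fun g _ => if_neg fun hh => h' (show z ∈ F.dom (i :: g) from (F.mem_frontier_dom_iff.1 hh.2).1).1

lemma lapBdry_succ_of_notMem {z : ℝ} (hz : z ∉ F.turningPoints) (m : ℕ) :
    F.lapBdry z (m + 1) = ∑ i with z ∈ F.I i, F.lapBdry (F.map i z) m := by
  rw [lapBdry_succ, Finset.sum_filter]
  refine Finset.sum_congr rfl fun i _ => ?_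
  by_cases h : z ∈ F.I i
  · rw [if_pos (F.mem_Ioo_of_mem_I hz h), if_pos h]
  · rw [if_neg fun hh => h (Ioo_subset_Icc_self hh), if_neg h, if_neg h]

end IntervalSystem

/-! ### One-sided germs and the invariant coordinate -/

/-- A germ of an interval at one side of a real number, encoded as the filter of one-sided
neighbourhoods. -/
def IsGerm (l : Filter ℝ) : Prop := ∃ z, l = 𝓝[>] z ∨ l = 𝓝[<] z

lemma isGerm_nhdsGT (z : ℝ) : IsGerm (𝓝[>] z) := ⟨z, Or.inl rfl⟩

lemma isGerm_nhdsLT (z : ℝ) : IsGerm (𝓝[<] z) := ⟨z, Or.inr rfl⟩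

lemma IsGerm.neBot {l : Filter ℝ} (hl : IsGerm l) : l.NeBot := by
  obtain ⟨z, rfl | rfl⟩ := hl <;> infer_instance

lemma IsGerm.Ioi_or_Iio {l : Filter ℝ} (hl : IsGerm l) (z : ℝ) : Ioi z ∈ l ∨ Iio z ∈ l := by
  obtain ⟨x, rfl | rfl⟩ := hl
  · rcases le_or_gt z x with h | h
    · exact Or.inl (mem_of_superset self_mem_nhdsWithin (Ioi_subset_Ioi h))
    · exact Or.inr (mem_nhdsWithin_of_mem_nhds (Iio_mem_nhds h))
  · rcases lt_or_ge z x with h | h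
    · exact Or.inl (mem_nhdsWithin_of_mem_nhds (Ioi_mem_nhds h))
    · exact Or.inr (mem_of_superset self_mem_nhdsWithin (Iio_subset_Iio h))

lemma IsGerm.eventually_ne {l : Filter ℝ} (hl : IsGerm l) (z : ℝ) : ∀ᶠ y in l, y ≠ z := by
  rcases hl.Ioi_or_Iio z with h | h
  · filter_upwards [h] with y hy using ne_of_gt hy
  · filter_upwards [h] with y hy using ne_of_lt hy

lemma IsGerm.eventually_gt_iff {l : Filter ℝ} (hl : IsGerm l) (z : ℝ) :
    ∀ᶠ y in l, z < y ↔ Ioi z ∈ l := by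
  have := hl.neBot
  rcases hl.Ioi_or_Iio z with h | h
  · filter_upwards [h] with y hy using iff_of_true hy h
  · filter_upwards [h] with y hy
    refine iff_of_false (not_lt_of_gt hy) fun h' => ?_
    obtain ⟨x, hx1, hx2⟩ := Filter.nonempty_of_mem (inter_mem h h')
    exact lt_asymm (mem_Iio.1 hx1) (mem_Ioi.1 hx2)

namespace IntervalSystem

variable {n : ℕ} (F : IntervalSystem n)

lemma tp_mem (i : Fin F.numTP) : F.tp i ∈ F.turningPoints :=
  Finset.orderEmbOfFin_mem _ _ _

lemma exists_tp_eq {z : ℝ} (hz : z ∈ F.turningPoints) : ∃ i, F.tp i = z := by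
  have : z ∈ Set.range (F.turningPoints.orderEmbOfFin rfl) := by
    rw [Finset.range_orderEmbOfFin]; exact hz
  exact this

lemma tp_strictMono : StrictMono F.tp := (F.turningPoints.orderEmbOfFin rfl).strictMono

lemma eventually_notMem_turningPoints {l : Filter ℝ} (hl : IsGerm l) :
    ∀ᶠ y in l, y ∉ F.turningPoints := by
  have : ∀ᶠ y in l, ∀ z ∈ F.turningPoints, y ≠ z :=
    (Finset.eventually_all _).2 fun z _ => hl.eventually_ne z
  filter_upwards [this] with y hy h using hy y h rfl

lemma eventually_mem_I_iff {l : Filter ℝ} (hl : IsGerm l) :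
    ∀ᶠ y in l, ∀ i, y ∈ F.I i ↔ F.I i ∈ l := by
  have := hl.neBot
  refine eventually_all.2 fun i => ?_
  have key : (∀ᶠ y in l, y ∈ F.I i) ∨ ∀ᶠ y in l, y ∉ F.I i := by
    rcases hl.Ioi_or_Iio (F.left i) with h | h
    · rcases hl.Ioi_or_Iio (F.right i) with h' | h'
      · right
        filter_upwards [h'] with y hy hyI using not_le_of_gt hy hyI.2
      · left
        filter_upwards [h, h'] with y hy hy' using ⟨le_of_lt hy, le_of_lt hy'⟩
    · right
      filter_upwards [h] with y hy hyI using not_le_of_gt hy hyI.1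
  rcases key with h | h
  · filter_upwards [h] with y hy using iff_of_true hy h
  · filter_upwards [h] with y hy
    refine iff_of_false hy fun h' => ?_
    obtain ⟨x, hx1, hx2⟩ := (h.and h').exists
    exact hx1 hx2

lemma exists_mem_P (y : ℝ) : ∃ k, y ∈ F.P k := by
  have hne : ({k | ∀ i : Fin F.numTP, k ≤ i.castSucc → y ≤ F.tp i} :
      Set (Fin (F.numTP + 1))).Nonempty :=
    ⟨Fin.last _, fun i hi => absurd hi (not_le_of_gt (Fin.castSucc_lt_last i))⟩
  obtain ⟨k, hk, hmin⟩ := WellFounded.has_min wellFounded_lt _ hne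
  refine ⟨k, fun i => ⟨fun hi => ?_, hk i⟩⟩
  have := fun h => hmin i.castSucc h hi
  simp only [mem_ofPred_eq, imp_false, not_forall, not_le] at this
  obtain ⟨i', hi', hlt⟩ := this
  exact (F.tp_strictMono.monotone (Fin.castSucc_le_castSucc_iff.1 hi')).trans hlt.le

lemma eq_of_mem_P {y : ℝ} (hy : y ∉ F.turningPoints) {k k' : Fin (F.numTP + 1)}
    (hk : y ∈ F.P k) (hk' : y ∈ F.P k') : k = k' := by
  wlog h : k < k' generalizing k k'
  · rcases eq_or_lt_of_le (not_lt.1 h) with h | h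
    · exact h.symm
    · exact (this hk' hk h).symm
  · -- the turning point with the index of `k` separates the two pieces
    exfalso
    have hk1 : (k : ℕ) < F.numTP := lt_of_lt_of_le h (Nat.lt_succ_iff.1 k'.2)
    have h1 := (hk ⟨k, hk1⟩).2 (le_of_eq rfl)
    have h2 := (hk' ⟨k, hk1⟩).1 h
    exact hy (le_antisymm h1 h2 ▸ F.tp_mem _)

lemma address_of_mem_P {y : ℝ} (hy : y ∉ F.turningPoints) {k : Fin (F.numTP + 1)}
    (hk : y ∈ F.P k) (k' : Fin (F.numTP + 1)) :
    F.address y k' = if k' = k then 1 else 0 := by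
  rw [address, if_neg hy]
  congr 1
  exact propext ⟨fun h => F.eq_of_mem_P hy h hk, fun h => h ▸ hk⟩

/-- The endpoints of domains are turning points, so a piece meeting a domain off the turning points
is contained in it. -/
lemma P_subset_I_iff {y : ℝ} (hy : y ∉ F.turningPoints) {k : Fin (F.numTP + 1)}
    (hk : y ∈ F.P k) (i : Fin n) : F.P k ⊆ F.I i ↔ y ∈ F.I i := by
  refine ⟨fun h => h hk, fun h x hx => ?_⟩
  obtain ⟨a, ha⟩ := F.exists_tp_eq (F.left_mem_turningPoints i)
  obtain ⟨b, hb⟩ := F.exists_tp_eq (F.right_mem_turningPoints i)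
  have h' := F.mem_Ioo_of_mem_I hy h
  rw [← ha, ← hb] at h'
  rw [I, ← ha, ← hb]
  refine ⟨(hx a).1 (lt_of_not_ge fun hh => ?_), (hx b).2 (le_of_not_gt fun hh => ?_)⟩
  · exact not_le_of_gt h'.1 ((hk a).2 hh)
  · exact not_le_of_gt h'.2 ((hk b).1 hh)

lemma eventually_mem_P {l : Filter ℝ} (hl : IsGerm l) : ∃ k, ∀ᶠ y in l, y ∈ F.P k := by
  have := hl.neBot
  have h : ∀ᶠ y in l, ∀ i, F.tp i < y ↔ Ioi (F.tp i) ∈ l :=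
    eventually_all.2 fun i => hl.eventually_gt_iff _
  obtain ⟨y₀, hy₀, h0⟩ := ((F.eventually_notMem_turningPoints hl).and h).exists
  obtain ⟨k, hk⟩ := F.exists_mem_P y₀
  refine ⟨k, ?_⟩
  filter_upwards [h] with y hy i
  refine ⟨fun hi => ?_, fun hi => le_of_not_gt fun hlt => ?_⟩
  · have h1 : F.tp i < y₀ := lt_of_le_of_ne ((hk i).1 hi) fun e => hy₀ (e ▸ F.tp_mem i)
    exact ((hy i).2 ((h0 i).1 h1)).le
  · exact not_le_of_gt ((h0 i).2 ((hy i).1 hlt)) ((hk i).2 hi)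

lemma P_subset_I_iff_mem {l : Filter ℝ} (hl : IsGerm l) {k : Fin (F.numTP + 1)}
    (hk : ∀ᶠ y in l, y ∈ F.P k) (i : Fin n) : F.P k ⊆ F.I i ↔ F.I i ∈ l := by
  have := hl.neBot
  obtain ⟨y, ⟨hy, hyP⟩, hyI⟩ :=
    (((F.eventually_notMem_turningPoints hl).and hk).and (F.eventually_mem_I_iff hl)).exists
  rw [F.P_subset_I_iff hy hyP, hyI]

lemma eventually_mem_P_succ (j : Fin F.numTP) : ∀ᶠ y in 𝓝[>] (F.tp j), y ∈ F.P j.succ := by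
  have h : ∀ᶠ y in 𝓝[>] (F.tp j), ∀ i, j < i → y < F.tp i :=
    eventually_all.2 fun i => eventually_imp_distrib_left.2 fun hi =>
      mem_nhdsWithin_of_mem_nhds (Iio_mem_nhds (F.tp_strictMono hi))
  filter_upwards [h, self_mem_nhdsWithin] with y hy hy' i
  refine ⟨fun hi => ?_, fun hi => (hy i (Fin.succ_le_castSucc_iff.1 hi)).le⟩
  exact (F.tp_strictMono.monotone (Fin.castSucc_lt_succ_iff.1 hi)).trans (le_of_lt hy')

section Tendsto

variable {F} {i : Fin n} {z : ℝ}

lemma tendsto_map_of_mem_germ {l : Filter ℝ} (h : F.I i ∈ l) (hl : l ≤ 𝓝 z) (hz : z ∈ F.I i) :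
    Tendsto (F.map i) l (𝓝 (F.map i z)) :=
  (F.continuousOn_map i z hz).mono_left (le_inf hl (le_principal_iff.2 h))

lemma mem_I_of_mem_germ {l : Filter ℝ} [l.NeBot] (h : F.I i ∈ l) (hl : l ≤ 𝓝 z) : z ∈ F.I i :=
  isClosed_Icc.mem_of_tendsto (f := id) hl h

lemma tendsto_map_GT_of_strictMonoOn (hf : StrictMonoOn (F.map i) (F.I i))
    (h : F.I i ∈ 𝓝[>] z) : Tendsto (F.map i) (𝓝[>] z) (𝓝[>] (F.map i z)) := by
  have hz := mem_I_of_mem_germ h nhdsWithin_le_nhds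
  refine tendsto_nhdsWithin_iff.2
    ⟨tendsto_map_of_mem_germ h nhdsWithin_le_nhds hz, ?_⟩
  filter_upwards [h, self_mem_nhdsWithin] with y hy hy' using hf hz hy hy'

lemma tendsto_map_GT_of_strictAntiOn (hf : StrictAntiOn (F.map i) (F.I i))
    (h : F.I i ∈ 𝓝[>] z) : Tendsto (F.map i) (𝓝[>] z) (𝓝[<] (F.map i z)) := by
  have hz := mem_I_of_mem_germ h nhdsWithin_le_nhds
  refine tendsto_nhdsWithin_iff.2
    ⟨tendsto_map_of_mem_germ h nhdsWithin_le_nhds hz, ?_⟩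
  filter_upwards [h, self_mem_nhdsWithin] with y hy hy' using hf hz hy hy'

lemma tendsto_map_LT_of_strictMonoOn (hf : StrictMonoOn (F.map i) (F.I i))
    (h : F.I i ∈ 𝓝[<] z) : Tendsto (F.map i) (𝓝[<] z) (𝓝[<] (F.map i z)) := by
  have hz := mem_I_of_mem_germ h nhdsWithin_le_nhds
  refine tendsto_nhdsWithin_iff.2
    ⟨tendsto_map_of_mem_germ h nhdsWithin_le_nhds hz, ?_⟩
  filter_upwards [h, self_mem_nhdsWithin] with y hy hy' using hf hy hz hy'

lemma tendsto_map_LT_of_strictAntiOn (hf : StrictAntiOn (F.map i) (F.I i))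
    (h : F.I i ∈ 𝓝[<] z) : Tendsto (F.map i) (𝓝[<] z) (𝓝[>] (F.map i z)) := by
  have hz := mem_I_of_mem_germ h nhdsWithin_le_nhds
  refine tendsto_nhdsWithin_iff.2
    ⟨tendsto_map_of_mem_germ h nhdsWithin_le_nhds hz, ?_⟩
  filter_upwards [h, self_mem_nhdsWithin] with y hy hy' using hf hy hz hy'

end Tendsto

lemma exists_tendsto_germ {l : Filter ℝ} (hl : IsGerm l) {i : Fin n} (h : F.I i ∈ l) :
    ∃ l', IsGerm l' ∧ Tendsto (F.map i) l l' := by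
  obtain ⟨z, rfl | rfl⟩ := hl <;> rcases F.strictMonotone_map i with hf | hf
  · exact ⟨_, isGerm_nhdsGT _, tendsto_map_GT_of_strictMonoOn hf h⟩
  · exact ⟨_, isGerm_nhdsLT _, tendsto_map_GT_of_strictAntiOn hf h⟩
  · exact ⟨_, isGerm_nhdsLT _, tendsto_map_LT_of_strictMonoOn hf h⟩
  · exact ⟨_, isGerm_nhdsGT _, tendsto_map_LT_of_strictAntiOn hf h⟩

/-- The family `l'` consists of germs to which the letters defined on the germ `l` map it. The values
of `l'` at the other letters are irrelevant. -/
def IsImage (l : Filter ℝ) (l' : Fin n → Filter ℝ) : Prop :=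
  ∀ i, F.I i ∈ l → IsGerm (l' i) ∧ Tendsto (F.map i) l (l' i)

lemma exists_isImage {l : Filter ℝ} (hl : IsGerm l) : ∃ l', F.IsImage l l' := by
  have : ∀ i, ∃ l', F.I i ∈ l → IsGerm l' ∧ Tendsto (F.map i) l l' := fun i => by
    by_cases h : F.I i ∈ l
    · obtain ⟨l', h'⟩ := F.exists_tendsto_germ hl h
      exact ⟨l', fun _ => h'⟩
    · exact ⟨l, fun h' => absurd h' h⟩
  choose l' hl' using this
  exact ⟨l', hl'⟩

/-- The limit of `θ_j` along a germ, coefficientwise for the discrete topology on `ℚ`. -/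
noncomputable def thetaGerm (l : Filter ℝ) (j : Fin (F.numTP + 1)) : PowerSeries ℚ :=
  PowerSeries.mk fun m =>
    letI : TopologicalSpace ℚ := ⊥
    limUnder l fun y => PowerSeries.coeff m (F.theta y j)

lemma thetaRight_eq (z : ℝ) : F.thetaRight z = F.thetaGerm (𝓝[>] z) := rfl

lemma thetaLeft_eq (z : ℝ) : F.thetaLeft z = F.thetaGerm (𝓝[<] z) := rfl

lemma coeff_thetaGerm_eq {l : Filter ℝ} [l.NeBot] {j : Fin (F.numTP + 1)} {m : ℕ} {v : ℚ}
    (h : ∀ᶠ y in l, PowerSeries.coeff m (F.theta y j) = v) :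
    PowerSeries.coeff m (F.thetaGerm l j) = v := by
  rw [thetaGerm, PowerSeries.coeff_mk]
  let : TopologicalSpace ℚ := ⊥
  have : DiscreteTopology ℚ := ⟨rfl⟩
  exact (tendsto_const_nhds.congr' (EventuallyEq.symm h)).limUnder_eq

lemma eventually_coeff_theta_eq {l : Filter ℝ} (hl : IsGerm l) (j : Fin (F.numTP + 1)) (m : ℕ) :
    ∀ᶠ y in l, PowerSeries.coeff m (F.theta y j) = PowerSeries.coeff m (F.thetaGerm l j) := by
  suffices ∃ v, ∀ᶠ y in l, PowerSeries.coeff m (F.theta y j) = v by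
    obtain ⟨v, hv⟩ := this
    have := hl.neBot
    rwa [F.coeff_thetaGerm_eq hv]
  induction m generalizing l with
  | zero =>
    obtain ⟨k, hk⟩ := F.eventually_mem_P hl
    refine ⟨if j = k then 1 else 0, ?_⟩
    filter_upwards [hk, F.eventually_notMem_turningPoints hl] with y hy hy'
    rw [coeff_zero_theta, F.address_of_mem_P hy' hy]
  | succ m ih =>
    obtain ⟨l', hl'⟩ := F.exists_isImage hl
    have : ∀ i, ∃ v, F.I i ∈ l →
        ∀ᶠ y in l, PowerSeries.coeff m (F.theta (F.map i y) j) = v := fun i => by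
      by_cases h : F.I i ∈ l
      · obtain ⟨v, hv⟩ := ih (hl' i h).1
        exact ⟨v, fun _ => (hl' i h).2.eventually hv⟩
      · exact ⟨0, fun h' => absurd h' h⟩
    choose v hv using this
    refine ⟨∑ i with F.I i ∈ l, F.letterSign i * v i, ?_⟩
    have hv' : ∀ᶠ y in l, ∀ i, F.I i ∈ l → PowerSeries.coeff m (F.theta (F.map i y) j) = v i :=
      eventually_all.2 fun i => eventually_imp_distrib_left.2 (hv i)
    filter_upwards [hv', F.eventually_notMem_turningPoints hl, F.eventually_mem_I_iff hl]
      with y hy hy' hyI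
    rw [F.coeff_succ_theta hy']
    simp only [hyI]
    exact Finset.sum_congr rfl fun i hi => by rw [hy i (Finset.mem_filter.1 hi).2]

/-- The renewal equation for the coefficients of `θ` along a germ. -/
lemma coeff_succ_thetaGerm {l : Filter ℝ} (hl : IsGerm l) {l' : Fin n → Filter ℝ}
    (hl' : F.IsImage l l') (j : Fin (F.numTP + 1)) (m : ℕ) :
    PowerSeries.coeff (m + 1) (F.thetaGerm l j) =
      ∑ i with F.I i ∈ l, F.letterSign i * PowerSeries.coeff m (F.thetaGerm (l' i) j) := by
  have := hl.neBot
  have hv : ∀ᶠ y in l, ∀ i, F.I i ∈ l → PowerSeries.coeff m (F.theta (F.map i y) j) =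
      PowerSeries.coeff m (F.thetaGerm (l' i) j) :=
    eventually_all.2 fun i => eventually_imp_distrib_left.2 fun h =>
      (hl' i h).2.eventually (F.eventually_coeff_theta_eq (hl' i h).1 j m)
  refine F.coeff_thetaGerm_eq ?_
  filter_upwards [hv, F.eventually_notMem_turningPoints hl, F.eventually_mem_I_iff hl]
    with y hy hy' hyI
  rw [F.coeff_succ_theta hy']
  simp only [hyI]
  exact Finset.sum_congr rfl fun i hi => by rw [hy i (Finset.mem_filter.1 hi).2]

lemma coeff_zero_thetaGerm {l : Filter ℝ} (hl : IsGerm l) {k : Fin (F.numTP + 1)}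
    (hk : ∀ᶠ y in l, y ∈ F.P k) (j : Fin (F.numTP + 1)) :
    PowerSeries.coeff 0 (F.thetaGerm l j) = if j = k then 1 else 0 := by
  have := hl.neBot
  refine F.coeff_thetaGerm_eq ?_
  filter_upwards [hk, F.eventually_notMem_turningPoints hl] with y hy hy'
  rw [coeff_zero_theta, F.address_of_mem_P hy' hy]

/-- The renewal equation as an identity of power series. -/
lemma thetaGerm_eq {l : Filter ℝ} (hl : IsGerm l) {l' : Fin n → Filter ℝ}
    (hl' : F.IsImage l l') {k : Fin (F.numTP + 1)} (hk : ∀ᶠ y in l, y ∈ F.P k)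
    (j : Fin (F.numTP + 1)) :
    F.thetaGerm l j = (if j = k then 1 else 0) +
      PowerSeries.X * ∑ i with F.I i ∈ l, PowerSeries.C (F.letterSign i) * F.thetaGerm (l' i) j := by
  ext m
  cases m with
  | zero =>
    rw [F.coeff_zero_thetaGerm hl hk]
    split_ifs <;> simp
  | succ m =>
    rw [F.coeff_succ_thetaGerm hl hl', map_add, PowerSeries.coeff_succ_X_mul, map_sum]
    simp only [PowerSeries.coeff_C_mul]
    split_ifs <;> simp [PowerSeries.coeff_one]

/-- As the right-hand side does not depend on the germ, `e` is orthogonal to all differences of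
invariant coordinates. -/
lemma sum_thetaGerm_mul_e {l : Filter ℝ} (hl : IsGerm l) :
    ∑ k, F.thetaGerm l k * F.e k = 1 := by
  suffices ∀ m, PowerSeries.coeff m (∑ k, F.thetaGerm l k * F.e k - 1) = 0 by
    exact sub_eq_zero.1 (PowerSeries.ext fun m => by simpa using this m)
  intro m
  have renewal : ∀ {l : Filter ℝ}, IsGerm l → ∀ {l'}, F.IsImage l l' →
      ∑ k, F.thetaGerm l k * F.e k - 1 = PowerSeries.X * ∑ i with F.I i ∈ l,
        PowerSeries.C (F.letterSign i) * (∑ k, F.thetaGerm (l' i) k * F.e k - 1) := by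
    intro l hl l' hl'
    obtain ⟨k₀, hk⟩ := F.eventually_mem_P hl
    have he : F.e k₀ = 1 - PowerSeries.X * ∑ i with F.I i ∈ l, PowerSeries.C (F.letterSign i) := by
      rw [e, ← Finset.sum_mul, mul_comm]
      simp only [F.P_subset_I_iff_mem hl hk]
    simp only [F.thetaGerm_eq hl hl' hk, add_mul, Finset.sum_add_distrib, ite_mul, one_mul,
      zero_mul, Finset.sum_ite_eq', Finset.mem_univ, if_true, he, mul_sub, mul_one,
      Finset.sum_sub_distrib]
    have : ∑ k, (PowerSeries.X * ∑ i with F.I i ∈ l,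
        PowerSeries.C (F.letterSign i) * F.thetaGerm (l' i) k) * F.e k =
        PowerSeries.X * ∑ i with F.I i ∈ l,
          PowerSeries.C (F.letterSign i) * ∑ k, F.thetaGerm (l' i) k * F.e k := by
      simp only [mul_assoc, Finset.sum_mul, Finset.mul_sum]
      rw [Finset.sum_comm]
    rw [this]
    ring
  induction m generalizing l with
  | zero =>
    obtain ⟨l', hl'⟩ := F.exists_isImage hl
    rw [renewal hl hl']
    simp
  | succ m ih =>
    obtain ⟨l', hl'⟩ := F.exists_isImage hl
    rw [renewal hl hl', PowerSeries.coeff_succ_X_mul, map_sum]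
    refine Finset.sum_eq_zero fun i hi => ?_
    rw [PowerSeries.coeff_C_mul, ih (hl' i (Finset.mem_filter.1 hi).2).1, mul_zero]

lemma sum_kneadingMatrix_mul_e (i : Fin F.numTP) :
    ∑ k, F.kneadingMatrix i k * F.e k = 0 := by
  simp only [kneadingMatrix, Matrix.of_apply, sub_mul, Finset.sum_sub_distrib, thetaRight_eq,
    thetaLeft_eq]
  rw [F.sum_thetaGerm_mul_e (isGerm_nhdsGT _), F.sum_thetaGerm_mul_e (isGerm_nhdsLT _), sub_self]

lemma constantCoeff_e (k : Fin (F.numTP + 1)) : PowerSeries.constantCoeff (F.e k) = 1 := by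
  simp [e]

lemma e_ne_zero (k : Fin (F.numTP + 1)) : F.e k ≠ 0 := fun h => by
  have := F.constantCoeff_e k
  simp [h] at this

/-- The kneading determinant does not depend on the deleted column. -/
lemma kneadingDet_eq (j : Fin (F.numTP + 1)) : F.kneadingDet j = F.kneadingDet 0 := by
  -- scaling the columns by the `e k` makes all row sums vanish
  set M : Matrix (Fin F.numTP) (Fin (F.numTP + 1)) (PowerSeries ℚ) :=
    Matrix.of fun i k => F.kneadingMatrix i k * F.e k with hM
  have hrow : ∀ i, ∑ k, M i k = 0 := F.sum_kneadingMatrix_mul_e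
  have hdet : ∀ j : Fin (F.numTP + 1), (M.submatrix id j.succAbove).det =
      (∏ k, F.e k) * ((F.e j)⁻¹ * (F.kneadingMatrix.submatrix id j.succAbove).det) := by
    intro j
    have h1 : (F.e j) * (F.e j)⁻¹ = 1 :=
      PowerSeries.mul_inv_cancel _ (by rw [constantCoeff_e]; exact one_ne_zero)
    have h2 : (M.submatrix id j.succAbove).det =
        (∏ k, F.e (j.succAbove k)) * (F.kneadingMatrix.submatrix id j.succAbove).det := by
      rw [← Matrix.det_mul_row]
      congr 1
      ext i k : 2
      simp [hM, mul_comm]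
    rw [h2, Fin.prod_univ_succAbove _ j]
    linear_combination (-(∏ k, F.e (j.succAbove k)) *
      (F.kneadingMatrix.submatrix id j.succAbove).det) * h1
  have h := Matrix.submatrix_succAbove_det_eq_negOnePow_submatrix_succAbove_det' M hrow j 0
  rw [hdet, hdet] at h
  have hE : (∏ k, F.e k) ≠ 0 := Finset.prod_ne_zero_iff.2 fun k _ => F.e_ne_zero k
  have hsign : (Int.negOnePow ((j : ℕ) : ℤ) : ℤˣ) = (-1) ^ (j : ℕ) := by
    simp [Int.negOnePow_def]
  have h' : (F.e j)⁻¹ * (F.kneadingMatrix.submatrix id j.succAbove).det =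
      (-1) ^ (j : ℕ) * ((F.e 0)⁻¹ *
        (F.kneadingMatrix.submatrix id (Fin.succAbove 0)).det) := by
    refine mul_left_cancel₀ hE ?_
    rw [h]
    simp only [Fin.val_zero, Nat.cast_zero, sub_zero, hsign, Units.smul_def, zsmul_eq_mul]
    push_cast
    ring
  rw [kneadingDet, kneadingDet, mul_assoc, h', ← mul_assoc, ← pow_add, ← two_mul]
  simp

lemma kneadingDet_zero : F.kneadingDet 0 = (F.kneadingMatrix.submatrix id Fin.succ).det := by
  have he : F.e 0 = 1 := by
    rw [e, Finset.filter_eq_empty_iff.2, Finset.sum_empty, sub_zero]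
    intro i _ h
    -- the leftmost piece is unbounded below
    obtain ⟨y, hy⟩ := (F.turningPoints ∪ {F.left i}).finite_toSet.bddBelow
    have hP : y - 1 ∈ F.P 0 := fun k => ⟨fun hk => absurd hk (Fin.not_lt_zero _), fun _ => by
      have := hy (Finset.mem_coe.2 (Finset.mem_union_left _ (F.tp_mem k)))
      linarith⟩
    have h1 := (h hP).1
    have h2 := hy (Finset.mem_coe.2 (Finset.mem_union_right _ (Finset.mem_singleton_self _)))
    linarith
  rw [kneadingDet, he]
  simp [Fin.succAbove_zero]

end IntervalSystem

/-! ### Jumps and first hits of turning points -/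

namespace IntervalSystem

variable {n : ℕ} (F : IntervalSystem n)

/-- The jump `θ_j(z⁺) - θ_j(z⁻)` at an arbitrary point `z`. -/
noncomputable def jump (z : ℝ) (j : Fin (F.numTP + 1)) : PowerSeries ℚ :=
  F.thetaGerm (𝓝[>] z) j - F.thetaGerm (𝓝[<] z) j

lemma letterSign_of_strictMonoOn {i : Fin n} (h : StrictMonoOn (F.map i) (F.I i)) :
    F.letterSign i = 1 := if_pos h

lemma letterSign_of_strictAntiOn {i : Fin n} (h : StrictAntiOn (F.map i) (F.I i)) :
    F.letterSign i = -1 := by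
  refine if_neg fun h' => ?_
  have h1 : F.left i ∈ F.I i := left_mem_Icc.2 (F.left_lt_right i).le
  have h2 : F.right i ∈ F.I i := right_mem_Icc.2 (F.left_lt_right i).le
  exact lt_asymm (h' h1 h2 (F.left_lt_right i)) (h h1 h2 (F.left_lt_right i))

lemma abs_letterSign (i : Fin n) : |F.letterSign i| = 1 := by
  rw [letterSign]; split_ifs <;> simp

/-- A letter transports the jump at a point `z` in the interior of its domain to the jump at the
image of `z`: an orientation reversing letter exchanges the sides, which its sign compensates. -/
lemma letterSign_mul_sub_eq_jump {i : Fin n} {z : ℝ}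
    (hz : z ∈ Ioo (F.left i) (F.right i)) {r l : Filter ℝ} (hr : IsGerm r)
    (hr' : Tendsto (F.map i) (𝓝[>] z) r) (hl : IsGerm l) (hl' : Tendsto (F.map i) (𝓝[<] z) l)
    (j : Fin (F.numTP + 1)) (m : ℕ) :
    F.letterSign i * PowerSeries.coeff m (F.thetaGerm r j) -
      F.letterSign i * PowerSeries.coeff m (F.thetaGerm l j) =
    PowerSeries.coeff m (F.jump (F.map i z) j) := by
  have hI : F.I i ∈ 𝓝 z := Icc_mem_nhds hz.1 hz.2
  -- `θ` has the same limit along all germs to which the letter maps a given germ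
  have common : ∀ {k l₁ l₂ : Filter ℝ}, IsGerm k → IsGerm l₁ → IsGerm l₂ →
      Tendsto (F.map i) k l₁ → Tendsto (F.map i) k l₂ →
      PowerSeries.coeff m (F.thetaGerm l₁ j) = PowerSeries.coeff m (F.thetaGerm l₂ j) := by
    intro k l₁ l₂ hk h₁ h₂ t₁ t₂
    have := hk.neBot
    obtain ⟨y, hy₁, hy₂⟩ := ((t₁.eventually (F.eventually_coeff_theta_eq h₁ j m)).and
      (t₂.eventually (F.eventually_coeff_theta_eq h₂ j m))).exists
    rw [← hy₁, hy₂]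
  have hIr : F.I i ∈ 𝓝[>] z := mem_nhdsWithin_of_mem_nhds hI
  have hIl : F.I i ∈ 𝓝[<] z := mem_nhdsWithin_of_mem_nhds hI
  rw [jump, map_sub]
  rcases F.strictMonotone_map i with h | h
  · rw [F.letterSign_of_strictMonoOn h,
      common (isGerm_nhdsGT z) hr (isGerm_nhdsGT _) hr' (tendsto_map_GT_of_strictMonoOn h hIr),
      common (isGerm_nhdsLT z) hl (isGerm_nhdsLT _) hl' (tendsto_map_LT_of_strictMonoOn h hIl)]
    ring
  · rw [F.letterSign_of_strictAntiOn h,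
      common (isGerm_nhdsGT z) hr (isGerm_nhdsLT _) hr' (tendsto_map_GT_of_strictAntiOn h hIr),
      common (isGerm_nhdsLT z) hl (isGerm_nhdsGT _) hl' (tendsto_map_LT_of_strictAntiOn h hIl)]
    ring

lemma I_mem_nhdsGT_iff {i : Fin n} {z : ℝ} :
    F.I i ∈ 𝓝[>] z ↔ F.left i ≤ z ∧ z < F.right i := by
  constructor
  · intro h
    have hz := mem_I_of_mem_germ h nhdsWithin_le_nhds
    obtain ⟨y, hy, hy'⟩ := Filter.nonempty_of_mem (inter_mem h self_mem_nhdsWithin)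
    exact ⟨hz.1, lt_of_lt_of_le hy' hy.2⟩
  · rintro ⟨h1, h2⟩
    filter_upwards [Ioo_mem_nhdsGT h2] with y hy using ⟨h1.trans hy.1.le, hy.2.le⟩

lemma I_mem_nhdsLT_iff {i : Fin n} {z : ℝ} :
    F.I i ∈ 𝓝[<] z ↔ F.left i < z ∧ z ≤ F.right i := by
  constructor
  · intro h
    have hz := mem_I_of_mem_germ h nhdsWithin_le_nhds
    obtain ⟨y, hy, hy'⟩ := Filter.nonempty_of_mem (inter_mem h self_mem_nhdsWithin)
    exact ⟨lt_of_le_of_lt hy.1 hy', hz.2⟩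
  · rintro ⟨h1, h2⟩
    filter_upwards [Ioo_mem_nhdsLT h1] with y hy using ⟨hy.1.le, hy.2.le.trans h2⟩

/-- Recursion for the jumps at an arbitrary point: letters with `z` in the interior of their
domain transport jumps, the other ones contribute one-sided limits. -/
lemma coeff_succ_jump {z : ℝ} {r l : Fin n → Filter ℝ} (hr : F.IsImage (𝓝[>] z) r)
    (hl : F.IsImage (𝓝[<] z) l) (j : Fin (F.numTP + 1)) (m : ℕ) :
    PowerSeries.coeff (m + 1) (F.jump z j) = ∑ i,
      if z ∈ Ioo (F.left i) (F.right i) then PowerSeries.coeff m (F.jump (F.map i z) j)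
      else if z = F.left i then F.letterSign i * PowerSeries.coeff m (F.thetaGerm (r i) j)
      else if z = F.right i then -(F.letterSign i * PowerSeries.coeff m (F.thetaGerm (l i) j))
      else 0 := by
  rw [jump, map_sub, F.coeff_succ_thetaGerm (isGerm_nhdsGT z) hr,
    F.coeff_succ_thetaGerm (isGerm_nhdsLT z) hl, Finset.sum_filter, Finset.sum_filter,
    ← Finset.sum_sub_distrib]
  refine Finset.sum_congr rfl fun i _ => ?_
  have hlt := F.left_lt_right i
  split_ifs with h1 h2 h3 h4 h5 h6 h7 h8 h9 h10
  all_goals first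
    | exact F.letterSign_mul_sub_eq_jump h3 (hr i h1).1 (hr i h1).2 (hl i h2).1 (hl i h2).2 j m
    | (rw [F.I_mem_nhdsGT_iff, F.I_mem_nhdsLT_iff] at *; simp only [mem_Ioo, not_and_or, not_le, not_lt] at *; grind)

lemma coeff_zero_jump {z : ℝ} (hz : z ∉ F.turningPoints) (j : Fin (F.numTP + 1)) :
    PowerSeries.coeff 0 (F.jump z j) = 0 := by
  obtain ⟨k, hk⟩ := F.exists_mem_P z
  -- the piece containing `z` is a neighbourhood of `z`
  have hP : ∀ᶠ y in 𝓝 z, y ∈ F.P k := by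
    refine eventually_all.2 fun i => ?_
    have hne : F.tp i ≠ z := fun e => hz (e ▸ F.tp_mem i)
    refine (eventually_imp_distrib_left.2 fun hi => ?_).and
      (eventually_imp_distrib_left.2 fun hi => ?_)
    · exact (eventually_gt_nhds (lt_of_le_of_ne ((hk i).1 hi) hne)).mono fun y => le_of_lt
    · exact (eventually_lt_nhds (lt_of_le_of_ne ((hk i).2 hi) hne.symm)).mono fun y => le_of_lt
  rw [jump, map_sub, F.coeff_zero_thetaGerm (isGerm_nhdsGT z) (nhdsWithin_le_nhds hP),
    F.coeff_zero_thetaGerm (isGerm_nhdsLT z) (nhdsWithin_le_nhds hP), sub_self]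

lemma coeff_succ_jump_of_notMem {z : ℝ} (hz : z ∉ F.turningPoints) (j : Fin (F.numTP + 1))
    (m : ℕ) : PowerSeries.coeff (m + 1) (F.jump z j) =
      ∑ i with z ∈ F.I i, PowerSeries.coeff m (F.jump (F.map i z) j) := by
  obtain ⟨r, hr⟩ := F.exists_isImage (isGerm_nhdsGT z)
  obtain ⟨l, hl⟩ := F.exists_isImage (isGerm_nhdsLT z)
  rw [F.coeff_succ_jump hr hl, Finset.sum_filter]
  refine Finset.sum_congr rfl fun i _ => ?_
  by_cases h : z ∈ F.I i
  · rw [if_pos (F.mem_Ioo_of_mem_I hz h), if_pos h]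
  · rw [if_neg fun hh => h (Ioo_subset_Icc_self hh), if_neg h,
      if_neg fun e : z = F.left i => hz (e ▸ F.left_mem_turningPoints i),
      if_neg fun e : z = F.right i => hz (e ▸ F.right_mem_turningPoints i)]

/-- The number of words `h` of length `m` such that `f_h z = c` and no proper prefix of `h` maps
`z` to a turning point. -/
noncomputable def hit (c : ℝ) : ℕ → ℝ → ℕ
  | 0, z => if z = c then 1 else 0
  | m + 1, z => if z ∈ F.turningPoints then 0 else ∑ i with z ∈ F.I i, hit c m (F.map i z)

lemma hit_of_mem {z : ℝ} (hz : z ∈ F.turningPoints) (c : ℝ) (m : ℕ) :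
    F.hit c m z = if m = 0 ∧ z = c then 1 else 0 := by
  cases m <;> simp [hit, hz]

/-- A sequence of functions which satisfies off the turning points the recursion given by splitting
off the first letter is determined by its values at the turning points, through the words leading
to a turning point for the first time. -/
lemma eq_sum_hit_mul {A : ℕ → ℝ → ℚ} (h0 : ∀ z ∉ F.turningPoints, A 0 z = 0)
    (hsucc : ∀ z ∉ F.turningPoints, ∀ m, A (m + 1) z = ∑ i with z ∈ F.I i, A m (F.map i z))
    (m : ℕ) (z : ℝ) :
    A m z = ∑ k, ∑ p ∈ Finset.HasAntidiagonal.antidiagonal m, (F.hit (F.tp k) p.1 z : ℚ) * A p.2 (F.tp k) := by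
  induction m generalizing z with
  | zero =>
    by_cases hz : z ∈ F.turningPoints
    · obtain ⟨k, rfl⟩ := F.exists_tp_eq hz
      rw [Finset.sum_eq_single k]
      · simp [hit]
      · intro k' _ hk'
        simp [hit, F.tp_strictMono.injective.ne hk'.symm]
      · simp
    · rw [h0 z hz]
      symm
      refine Finset.sum_eq_zero fun k _ => ?_
      have : z ≠ F.tp k := fun e => hz (e ▸ F.tp_mem k)
      simp [hit, this]
  | succ m ih =>
    by_cases hz : z ∈ F.turningPoints
    · obtain ⟨k, rfl⟩ := F.exists_tp_eq hz
      rw [Finset.sum_eq_single k]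
      · rw [Finset.Nat.sum_antidiagonal_succ]
        simp [F.hit_of_mem hz]
      · intro k' _ hk'
        simp [F.hit_of_mem hz, F.tp_strictMono.injective.ne hk'.symm]
      · simp
    · rw [hsucc z hz]
      have h1 : ∀ k, ∑ p ∈ Finset.HasAntidiagonal.antidiagonal (m + 1),
          (F.hit (F.tp k) p.1 z : ℚ) * A p.2 (F.tp k) =
          ∑ i with z ∈ F.I i, ∑ p ∈ Finset.HasAntidiagonal.antidiagonal m,
            (F.hit (F.tp k) p.1 (F.map i z) : ℚ) * A p.2 (F.tp k) := by
        intro k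
        have : z ≠ F.tp k := fun e => hz (e ▸ F.tp_mem k)
        rw [Finset.Nat.sum_antidiagonal_succ, Finset.sum_comm]
        simp [hit, this, hz, Finset.sum_mul]
      rw [Finset.sum_congr rfl fun k _ => h1 k, Finset.sum_comm]
      exact Finset.sum_congr rfl fun i _ => ih _

lemma coeff_jump_eq (m : ℕ) (z : ℝ) (j : Fin (F.numTP + 1)) :
    PowerSeries.coeff m (F.jump z j) = ∑ k, ∑ p ∈ Finset.HasAntidiagonal.antidiagonal m,
      (F.hit (F.tp k) p.1 z : ℚ) * PowerSeries.coeff p.2 (F.kneadingMatrix k j) :=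
  F.eq_sum_hit_mul (A := fun m z => PowerSeries.coeff m (F.jump z j))
    (fun _ hz => F.coeff_zero_jump hz j) (fun _ hz => F.coeff_succ_jump_of_notMem hz j) m z

lemma lapBdry_eq (m : ℕ) (z : ℝ) :
    (F.lapBdry z m : ℚ) = ∑ k, ∑ p ∈ Finset.HasAntidiagonal.antidiagonal m,
      (F.hit (F.tp k) p.1 z : ℚ) * F.lapBdry (F.tp k) p.2 :=
  F.eq_sum_hit_mul (A := fun m z => (F.lapBdry z m : ℚ))
    (fun z _ => by simp [lapBdry_zero])
    (fun z hz m => by simp [F.lapBdry_succ_of_notMem hz]) m z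

lemma finite_hit_ne_zero (c : ℝ) (m : ℕ) : {z | F.hit c m z ≠ 0}.Finite := by
  induction m with
  | zero => exact (finite_singleton c).subset fun z hz => by simpa [hit] using hz
  | succ m ih =>
    have : {z | F.hit c (m + 1) z ≠ 0} ⊆
        ⋃ i, F.I i ∩ F.map i ⁻¹' {z | F.hit c m z ≠ 0} := by
      intro z hz
      by_contra hcon
      apply hz
      rw [hit]
      split_ifs
      · rfl
      · refine Finset.sum_eq_zero fun i hi => ?_
        by_contra h
        exact hcon (mem_iUnion.2 ⟨i, (Finset.mem_filter.1 hi).2, h⟩)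
    refine (finite_iUnion fun i => ?_).subset this
    exact Set.Finite.of_finite_image (f := F.map i) (ih.subset (by rintro _ ⟨z, hz, rfl⟩; exact hz.2))
      ((F.injOn_map i).mono inter_subset_left)

lemma mem_or_of_hit_ne_zero {c : ℝ} {m : ℕ} {z : ℝ} (h : F.hit c m z ≠ 0) :
    z = c ∨ ∃ i, z ∈ F.I i := by
  cases m with
  | zero => exact Or.inl (by simpa [hit] using h)
  | succ m =>
    right
    by_contra! hcon
    apply h
    simp [hit, hcon]

/-- The generating function, by the length of the word, of the first hits of the turning point
`c_k` starting from points to the left of the germ `l`. -/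
noncomputable def hitSeries (l : Filter ℝ) (k : Fin F.numTP) : PowerSeries ℚ :=
  PowerSeries.mk fun m =>
    ∑ z ∈ (F.finite_hit_ne_zero (F.tp k) m).toFinset with Ioi z ∈ l, (F.hit (F.tp k) m z : ℚ)

lemma coeff_hitSeries {Z : Finset ℝ} {k : Fin F.numTP} {m : ℕ}
    (hZ : ∀ z, F.hit (F.tp k) m z ≠ 0 → z ∈ Z) (l : Filter ℝ) :
    PowerSeries.coeff m (F.hitSeries l k) =
      ∑ z ∈ Z with Ioi z ∈ l, (F.hit (F.tp k) m z : ℚ) := by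
  rw [hitSeries, PowerSeries.coeff_mk]
  refine Finset.sum_subset (fun z hz => ?_) fun z hz hz' => ?_
  · simp only [Finset.mem_filter, Finite.mem_toFinset] at hz ⊢
    exact ⟨hZ z hz.1, hz.2⟩
  · simp only [Finset.mem_filter, Finite.mem_toFinset] at hz hz'
    by_contra h
    exact hz' ⟨fun h' => h (by simp [h']), hz.2⟩

lemma exists_finset_hit (m : ℕ) : ∃ Z : Finset ℝ, ∀ k, ∀ p ≤ m, ∀ z,
    F.hit (F.tp k) p z ≠ 0 → z ∈ Z := by
  refine ⟨Finset.univ.biUnion fun k => (Finset.range (m + 1)).biUnion fun p =>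
    (F.finite_hit_ne_zero (F.tp k) p).toFinset, fun k p hp z hz => ?_⟩
  simp only [Finset.mem_biUnion, Finset.mem_univ, true_and, Finset.mem_range, Finite.mem_toFinset]
  exact ⟨k, p, Nat.lt_succ_of_le hp, hz⟩

/-- Summation over a set of starting points turns the relation between a function and its first
hits into a product of power series. -/
lemma sum_sum_hit_mul {m : ℕ} {Z : Finset ℝ}
    (hZ : ∀ k, ∀ p ≤ m, ∀ z, F.hit (F.tp k) p z ≠ 0 → z ∈ Z)
    (l : Filter ℝ) (A : Fin F.numTP → PowerSeries ℚ) :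
    ∑ z ∈ Z with Ioi z ∈ l, ∑ k, ∑ p ∈ Finset.HasAntidiagonal.antidiagonal m,
      (F.hit (F.tp k) p.1 z : ℚ) * PowerSeries.coeff p.2 (A k) =
    PowerSeries.coeff m (∑ k, F.hitSeries l k * A k) := by
  rw [Finset.sum_comm, map_sum]
  refine Finset.sum_congr rfl fun k _ => ?_
  rw [Finset.sum_comm, PowerSeries.coeff_mul]
  refine Finset.sum_congr rfl fun p hp => ?_
  rw [F.coeff_hitSeries (hZ k p.1 (Finset.HasAntidiagonal.antidiagonal.fst_le hp)), Finset.sum_mul]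

end IntervalSystem

/-- A function with one-sided limits (in the discrete topology) everywhere, which agree off a
finite set `Z`, is up to a constant the sum of its jumps. -/
lemma exists_eq_add_sum_jump {φ R L : ℝ → ℚ} {Z : Finset ℝ}
    (hR : ∀ x, ∀ᶠ y in 𝓝[>] x, φ y = R x) (hL : ∀ x, ∀ᶠ y in 𝓝[<] x, φ y = L x)
    (hZ : ∀ x ∉ Z, R x = L x) :
    ∃ C, ∀ x, L x = C + ∑ z ∈ Z with z < x, (R z - L z) ∧
      R x = C + ∑ z ∈ Z with z ≤ x, (R z - L z) := by
  have hsucc : ∀ x, ∑ z ∈ Z with z ≤ x, (R z - L z) =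
      ∑ z ∈ Z with z < x, (R z - L z) + (R x - L x) := by
    intro x
    by_cases hx : x ∈ Z
    · have : Finset.filter (fun z => z ≤ x) Z = insert x (Finset.filter (fun z => z < x) Z) := by
        ext z
        simp only [Finset.mem_filter, Finset.mem_insert, le_iff_lt_or_eq]
        grind
      rw [this, Finset.sum_insert (by simp), add_comm]
    · have : Finset.filter (fun z => z ≤ x) Z = Finset.filter (fun z => z < x) Z := by
        ext z
        simp only [Finset.mem_filter, le_iff_lt_or_eq]
        grind
      rw [this, hZ x hx, sub_self, add_zero]
  have hconst : IsLocallyConstant fun x => L x - ∑ z ∈ Z with z < x, (R z - L z) := by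
    rw [IsLocallyConstant.iff_eventually_eq]
    intro x
    rw [← nhdsNE_sup_pure, ← nhdsLT_sup_nhdsGT, eventually_sup, eventually_sup, eventually_pure]
    refine ⟨⟨?_, ?_⟩, rfl⟩
    · have hZ' : ∀ᶠ y in 𝓝[<] x, ∀ z ∈ Z, z < y ↔ z < x := by
        refine (Finset.eventually_all _).2 fun z _ => ?_
        rcases lt_or_ge z x with h | h
        · filter_upwards [mem_nhdsWithin_of_mem_nhds (Ioi_mem_nhds h)] with y hy
            using iff_of_true hy h
        · filter_upwards [self_mem_nhdsWithin] with y hy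
            using iff_of_false (not_lt_of_ge ((le_of_lt hy).trans h)) (not_lt_of_ge h)
      filter_upwards [hZ', eventually_eventually_nhdsWithin.2 (hL x), self_mem_nhdsWithin]
        with y hy hφ hyx
      rw [IsOpen.nhdsWithin_eq isOpen_Iio hyx] at hφ
      obtain ⟨w, hw1, hw2⟩ := ((hL y).and (nhdsWithin_le_nhds hφ)).exists
      rw [Finset.filter_congr hy, ← hw1, hw2]
    · have hZ' : ∀ᶠ y in 𝓝[>] x, ∀ z ∈ Z, z < y ↔ z ≤ x := by
        refine (Finset.eventually_all _).2 fun z _ => ?_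
        rcases lt_or_ge x z with h | h
        · filter_upwards [mem_nhdsWithin_of_mem_nhds (Iio_mem_nhds h)] with y hy
            using iff_of_false (not_lt_of_gt hy) (not_le_of_gt h)
        · filter_upwards [self_mem_nhdsWithin] with y hy
            using iff_of_true (h.trans_lt hy) h
      filter_upwards [hZ', eventually_eventually_nhdsWithin.2 (hR x), self_mem_nhdsWithin]
        with y hy hφ hyx
      rw [IsOpen.nhdsWithin_eq isOpen_Ioi hyx] at hφ
      obtain ⟨w, hw1, hw2⟩ := ((hL y).and (nhdsWithin_le_nhds hφ)).exists
      rw [Finset.filter_congr hy, hsucc, ← hw1, hw2]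
      ring
  refine ⟨L 0 - ∑ z ∈ Z with z < 0, (R z - L z), fun x => ?_⟩
  have h := hconst.apply_eq_of_preconnectedSpace x 0
  beta_reduce at h
  rw [hsucc, ← h]
  constructor <;> ring

/-! ### The inverse of the kneading matrix and the lap series -/

namespace IntervalSystem

variable {n : ℕ} (F : IntervalSystem n)

/-- There is a germ to the left of any given finite set where no letter is defined. -/
lemma exists_lt_all (Z : Finset ℝ) : ∃ x, (∀ z ∈ Z, x < z) ∧ (∀ᶠ y in 𝓝[<] x, y ∈ F.P 0) ∧
    ∀ i, F.I i ∉ 𝓝[<] x := by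
  obtain ⟨y, hy⟩ := (Z ∪ F.turningPoints).finite_toSet.bddBelow
  have hlt : ∀ z ∈ Z ∪ F.turningPoints, y - 1 < z := fun z hz => by
    have := hy (Finset.mem_coe.2 hz)
    linarith
  refine ⟨y - 1, fun z hz => hlt z (Finset.mem_union_left _ hz), ?_, fun i hi => ?_⟩
  · filter_upwards [self_mem_nhdsWithin] with w hw k
    exact ⟨fun hk => absurd hk (Fin.not_lt_zero _), fun _ =>
      (lt_trans hw (hlt _ (Finset.mem_union_right _ (F.tp_mem k)))).le⟩
  · have h1 := (F.I_mem_nhdsLT_iff.1 hi).1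
    exact lt_asymm h1 (hlt _ (Finset.mem_union_right _ (F.left_mem_turningPoints i)))

/-- The invariant coordinate is the coordinate `P 0` at `-∞` plus all jumps to the left; and every
jump is a combination of the rows of the kneading matrix. -/
lemma thetaGerm_eq_add_sum {l : Filter ℝ} (hl : IsGerm l) (j : Fin (F.numTP + 1)) :
    F.thetaGerm l j = (if j = 0 then 1 else 0) + ∑ k, F.hitSeries l k * F.kneadingMatrix k j := by
  ext m
  obtain ⟨Z, hZ⟩ := F.exists_finset_hit m
  have hjump : ∀ z ∉ Z, PowerSeries.coeff m (F.jump z j) = 0 := by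
    intro z hz
    rw [coeff_jump_eq]
    refine Finset.sum_eq_zero fun k _ => Finset.sum_eq_zero fun p hp => ?_
    have : F.hit (F.tp k) p.1 z = 0 := by
      by_contra h
      exact hz (hZ k p.1 (Finset.HasAntidiagonal.antidiagonal.fst_le hp) z h)
    simp [this]
  obtain ⟨C, hC⟩ := exists_eq_add_sum_jump (φ := fun y => PowerSeries.coeff m (F.theta y j))
    (R := fun x => PowerSeries.coeff m (F.thetaGerm (𝓝[>] x) j))
    (L := fun x => PowerSeries.coeff m (F.thetaGerm (𝓝[<] x) j)) (Z := Z)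
    (fun x => F.eventually_coeff_theta_eq (isGerm_nhdsGT x) j m)
    (fun x => F.eventually_coeff_theta_eq (isGerm_nhdsLT x) j m)
    (fun x hx => sub_eq_zero.1 (by simpa [jump] using hjump x hx))
  have hCval : C = PowerSeries.coeff m (if j = 0 then 1 else 0 : PowerSeries ℚ) := by
    obtain ⟨x, hx, hP, hI⟩ := F.exists_lt_all Z
    have h := (hC x).1
    rw [Finset.filter_eq_empty_iff.2 fun z hz => not_lt_of_gt (hx z hz), Finset.sum_empty,
      add_zero] at h
    obtain ⟨l', hl'⟩ := F.exists_isImage (isGerm_nhdsLT x)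
    rw [← h, F.thetaGerm_eq (isGerm_nhdsLT x) hl' hP, Finset.filter_eq_empty_iff.2 fun i _ => hI i]
    simp
  have hsum : ∀ s : Finset ℝ, ∑ z ∈ s, (PowerSeries.coeff m (F.thetaGerm (𝓝[>] z) j) -
      PowerSeries.coeff m (F.thetaGerm (𝓝[<] z) j)) = ∑ z ∈ s, ∑ k,
        ∑ p ∈ Finset.HasAntidiagonal.antidiagonal m, (F.hit (F.tp k) p.1 z : ℚ) *
          PowerSeries.coeff p.2 (F.kneadingMatrix k j) := fun s =>
    Finset.sum_congr rfl fun z _ => by rw [← coeff_jump_eq, jump, map_sub]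
  rw [map_add, ← hCval, ← F.sum_sum_hit_mul hZ]
  obtain ⟨x, rfl | rfl⟩ := hl
  · rw [(hC x).2, hsum]
    congr 2
    refine Finset.filter_congr fun z _ => ⟨fun h => ?_, fun h => ?_⟩
    · exact mem_of_superset self_mem_nhdsWithin (Ioi_subset_Ioi h)
    · by_contra! hlt
      obtain ⟨y, hy1, hy2⟩ := Filter.nonempty_of_mem
        (inter_mem h (mem_nhdsWithin_of_mem_nhds (Iio_mem_nhds hlt)))
      exact lt_asymm (mem_Ioi.1 hy1) (mem_Iio.1 hy2)
  · rw [(hC x).1, hsum]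
    congr 2
    refine Finset.filter_congr fun z _ => ⟨fun h => ?_, fun h => ?_⟩
    · exact mem_nhdsWithin_of_mem_nhds (Ioi_mem_nhds h)
    · obtain ⟨y, hy1, hy2⟩ := Filter.nonempty_of_mem (inter_mem h self_mem_nhdsWithin)
      exact lt_trans (mem_Ioi.1 hy1) (mem_Iio.1 hy2)

/-- A choice of images of the germ `c_k⁺` under the letters defined on it. -/
noncomputable def tpImage (k : Fin F.numTP) : Fin n → Filter ℝ :=
  (F.exists_isImage (isGerm_nhdsGT (F.tp k))).choose

lemma isImage_tpImage (k : Fin F.numTP) : F.IsImage (𝓝[>] (F.tp k)) (F.tpImage k) :=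
  (F.exists_isImage (isGerm_nhdsGT (F.tp k))).choose_spec

/-- The inverse of the kneading matrix with its first column deleted. -/
noncomputable def hitMatrix : Matrix (Fin F.numTP) (Fin F.numTP) (PowerSeries ℚ) :=
  Matrix.of fun j k => F.hitSeries (𝓝[>] (F.tp j)) k - PowerSeries.X *
    ∑ i with F.I i ∈ 𝓝[>] (F.tp j), PowerSeries.C (F.letterSign i) * F.hitSeries (F.tpImage j i) k

lemma hitMatrix_mul : F.hitMatrix * F.kneadingMatrix.submatrix id Fin.succ = 1 := by
  ext1 j k
  have h := F.thetaGerm_eq (isGerm_nhdsGT (F.tp j)) (F.isImage_tpImage j)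
    (F.eventually_mem_P_succ j) k.succ
  have h0 : ∀ {l : Filter ℝ}, IsGerm l → F.thetaGerm l k.succ =
      ∑ q, F.hitSeries l q * F.kneadingMatrix q k.succ := fun hl => by
    rw [F.thetaGerm_eq_add_sum hl, if_neg (Fin.succ_ne_zero k), zero_add]
  have h1 : ∑ i with F.I i ∈ 𝓝[>] (F.tp j),
      PowerSeries.C (F.letterSign i) * F.thetaGerm (F.tpImage j i) k.succ =
      ∑ i with F.I i ∈ 𝓝[>] (F.tp j), PowerSeries.C (F.letterSign i) *
        ∑ q, F.hitSeries (F.tpImage j i) q * F.kneadingMatrix q k.succ :=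
    Finset.sum_congr rfl fun i hi => by
      rw [h0 (F.isImage_tpImage j i (Finset.mem_filter.1 hi).2).1]
  rw [h1, h0 (isGerm_nhdsGT _)] at h
  simp only [Fin.succ_inj, eq_comm (a := k) (b := j)] at h
  rw [Matrix.mul_apply, Matrix.one_apply]
  simp only [hitMatrix, Matrix.of_apply, Matrix.submatrix_apply, id, sub_mul,
    Finset.sum_sub_distrib]
  rw [h, add_sub_assoc, add_eq_left, sub_eq_zero]
  simp only [mul_assoc, Finset.sum_mul, Finset.mul_sum]
  exact Finset.sum_comm

lemma kneadingDet_mul_det : F.kneadingDet 0 * F.hitMatrix.det = 1 := by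
  rw [kneadingDet_zero, mul_comm, ← Matrix.det_mul, hitMatrix_mul, Matrix.det_one]

/-- Cramer's rule. -/
lemma adjugate_eq : (F.kneadingMatrix.submatrix id Fin.succ).adjugate =
    F.kneadingDet 0 • F.hitMatrix := by
  have h : F.kneadingMatrix.submatrix id Fin.succ * F.hitMatrix = 1 :=
    mul_eq_one_comm.1 F.hitMatrix_mul
  rw [kneadingDet_zero, ← mul_one (Matrix.adjugate _), ← h, ← mul_assoc, Matrix.adjugate_mul,
    smul_mul_assoc, one_mul]

/-- To the right of the last turning point no letter is defined and no turning point is hit. -/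
lemma hitMatrix_last {j : Fin F.numTP} (hj : ∀ k, k ≤ j) (k : Fin F.numTP) :
    F.hitMatrix j k = F.hitSeries atTop k := by
  have hle : ∀ z ∈ F.turningPoints, z ≤ F.tp j := fun z hz => by
    obtain ⟨k, rfl⟩ := F.exists_tp_eq hz
    exact F.tp_strictMono.monotone (hj k)
  rw [hitMatrix, Matrix.of_apply, Finset.filter_eq_empty_iff.2 fun i _ hi => ?_]
  · rw [Finset.sum_empty, mul_zero, sub_zero]
    refine PowerSeries.ext fun m => ?_
    rw [hitSeries, hitSeries, PowerSeries.coeff_mk, PowerSeries.coeff_mk]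
    refine Finset.sum_congr (Finset.filter_congr fun z hz => ?_) fun _ _ => rfl
    rw [Finite.mem_toFinset, mem_ofPred_eq] at hz
    refine iff_of_true ?_ (Ioi_mem_atTop z)
    refine mem_of_superset self_mem_nhdsWithin (Ioi_subset_Ioi ?_)
    rcases F.mem_or_of_hit_ne_zero hz with rfl | ⟨i, hi⟩
    · exact hle _ (F.tp_mem k)
    · exact hi.2.trans (hle _ (F.right_mem_turningPoints i))
  · exact not_lt_of_ge (hle _ (F.right_mem_turningPoints i)) (F.I_mem_nhdsGT_iff.1 hi).2

lemma exists_frontier_dom {g : List (Fin n)} (hg : g ≠ []) (h : (F.dom g).Nontrivial) :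
    ∃ a b, a ≠ b ∧ frontier (F.dom g) = {a, b} := by
  obtain ⟨i, g, rfl⟩ := List.exists_cons_of_ne_nil hg
  have hc : IsCompact (F.dom (i :: g)) :=
    isCompact_Icc.of_isClosed_subset (F.isClosed_dom _) fun x hx => hx.1
  have hconn : IsConnected (F.dom (i :: g)) :=
    ⟨h.nonempty, (F.ordConnected_dom _).isPreconnected⟩
  have heq := eq_Icc_of_connected_compact hconn hc
  rw [heq] at h ⊢
  have hlt : sInf (F.dom (i :: g)) < sSup (F.dom (i :: g)) := by
    by_contra! hle
    exact not_subsingleton_iff.2 h (subsingleton_Icc_of_ge hle)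
  exact ⟨_, _, hlt.ne, frontier_Icc hlt.le⟩

/-- Every domain of a word has two endpoints. -/
lemma two_mul_lap (m : ℕ) : ∃ Z₀ : Finset ℝ, ∀ Z, Z₀ ⊆ Z →
    2 * F.lap (m + 1) = ∑ z ∈ Z, F.lapBdry z (m + 1) := by
  have hfr : ∀ g ∈ F.words (m + 1), ∃ s : Finset ℝ, s.card = 2 ∧ (s : Set ℝ) = frontier (F.dom g) := by
    intro g hg
    rw [mem_words] at hg
    obtain ⟨a, b, hab, h⟩ := F.exists_frontier_dom (g := g) (by rintro rfl; simp at hg) hg.2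
    exact ⟨{a, b}, Finset.card_pair hab, by simp [h]⟩
  choose! s hs hs' using hfr
  refine ⟨(F.words (m + 1)).biUnion s, fun Z hZ => ?_⟩
  have h1 : ∀ z, F.lapBdry z (m + 1) = ∑ g ∈ F.words (m + 1), if z ∈ s g then 1 else 0 := by
    intro z
    rw [lapBdry, Finset.card_filter]
    refine Finset.sum_congr rfl fun g hg => ?_
    congr 1
    rw [← hs' g hg, Finset.mem_coe, eq_iff_iff, and_iff_right_iff_imp, ← Finset.mem_coe, hs' g hg]
    exact fun h => (F.mem_frontier_dom_iff.1 h).1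
  rw [Finset.sum_congr rfl fun z _ => h1 z, Finset.sum_comm, lap, Finset.card_eq_sum_ones,
    Finset.mul_sum]
  refine Finset.sum_congr rfl fun g hg => ?_
  rw [← Finset.card_filter, mul_one, ← hs g hg, Finset.filter_mem_eq_inter,
    Finset.inter_eq_right.2 ((Finset.subset_biUnion_of_mem s hg).trans hZ)]

/-- The generating function `∑_{m ≥ 1} ℓ'_{c_k}(m) t^{m-1}`. -/
noncomputable def bdrySeries (k : Fin F.numTP) : PowerSeries ℚ :=
  PowerSeries.mk fun m => (F.lapBdry (F.tp k) (m + 1) : ℚ)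

lemma coeff_two_mul (A : PowerSeries ℚ) (m : ℕ) :
    PowerSeries.coeff m (2 * A) = 2 * PowerSeries.coeff m A := by
  rw [two_mul, map_add, two_mul]

/-- An endpoint of the domain of a word is a point whose orbit hits, for the first time, a turning
point which is an endpoint of the domain of the remaining word. -/
lemma two_mul_lapSeries : 2 * F.lapSeries = ∑ k, F.hitSeries atTop k * F.bdrySeries k := by
  ext m
  obtain ⟨Z₀, hZ₀⟩ := F.two_mul_lap m
  obtain ⟨Z₁, hZ₁⟩ := F.exists_finset_hit m
  rw [← F.sum_sum_hit_mul (Z := Z₀ ∪ Z₁)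
    (fun k p hp z hz => Finset.mem_union_right _ (hZ₁ k p hp z hz)),
    Finset.filter_true_of_mem fun z _ => Ioi_mem_atTop z]
  rw [coeff_two_mul, lapSeries, PowerSeries.coeff_mk]
  have h := congrArg (Nat.cast : ℕ → ℚ) (hZ₀ (Z₀ ∪ Z₁) Finset.subset_union_left)
  push_cast at h
  rw [h]
  refine Finset.sum_congr rfl fun z _ => ?_
  rw [lapBdry_eq]
  refine Finset.sum_congr rfl fun k _ => ?_
  rw [Finset.Nat.sum_antidiagonal_succ']
  simp [lapBdry_zero, bdrySeries]

/-- The relation expressing `L` through `D` and series converging in the disk of radius `1/s₀`. -/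
lemma kneadingDet_mul_lapSeries {j : Fin F.numTP} (hj : ∀ k, k ≤ j) :
    F.kneadingDet 0 * (2 * F.lapSeries) = ∑ k,
      (F.kneadingMatrix.submatrix id Fin.succ).adjugate j k * F.bdrySeries k := by
  rw [two_mul_lapSeries, adjugate_eq, Finset.mul_sum]
  refine Finset.sum_congr rfl fun k _ => ?_
  rw [Matrix.smul_apply, smul_eq_mul, F.hitMatrix_last hj, mul_assoc]

lemma edgeCount_pos_of_endpoint {z : ℝ} {i : Fin n} (hz : z = F.left i ∨ z = F.right i) :
    1 ≤ F.edgeCount i z 0 := by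
  have hI : z ∈ F.I i := by
    rcases hz with rfl | rfl
    · exact left_mem_Icc.2 (F.left_lt_right i).le
    · exact right_mem_Icc.2 (F.left_lt_right i).le
  rw [edgeCount, Nat.one_le_iff_ne_zero, ← Nat.pos_iff_ne_zero, Finset.card_pos]
  refine ⟨[], Finset.mem_filter.2 ⟨by simp, ?_, hI, trivial⟩⟩
  exact ⟨F.left i, ⟨left_mem_Icc.2 (F.left_lt_right i).le, trivial⟩, F.right i,
    ⟨right_mem_Icc.2 (F.left_lt_right i).le, trivial⟩, (F.left_lt_right i).ne⟩

lemma one_le_lapBdry_one {z : ℝ} (hz : z ∈ F.turningPoints) : 1 ≤ F.lapBdry z 1 := by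
  obtain ⟨i, hi⟩ : ∃ i, z = F.left i ∨ z = F.right i := by
    simp only [turningPoints, Finset.mem_union, Finset.mem_image, Finset.mem_univ, true_and] at hz
    obtain ⟨i, hi⟩ | ⟨i, hi⟩ := hz
    · exact ⟨i, Or.inl hi.symm⟩
    · exact ⟨i, Or.inr hi.symm⟩
  have hI : z ∈ F.I i := by
    rcases hi with rfl | rfl
    · exact left_mem_Icc.2 (F.left_lt_right i).le
    · exact right_mem_Icc.2 (F.left_lt_right i).le
  have hnot : z ∉ Ioo (F.left i) (F.right i) := by
    rcases hi with rfl | rfl <;> simp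
  rw [lapBdry_succ]
  refine le_trans ?_ (Finset.single_le_sum (fun _ _ => Nat.zero_le _) (Finset.mem_univ i))
  rw [if_neg hnot, if_pos hI]
  exact F.edgeCount_pos_of_endpoint hi

/-- At a germ in the domain of a letter `i` starting at an endpoint `z` of that domain, only words
counted by `edgeCount` contribute. -/
lemma abs_coeff_thetaGerm_le {i : Fin n} {z : ℝ} {l l' : Filter ℝ} (hl : IsGerm l)
    (hlz : l ≤ 𝓝 z) (hI : F.I i ∈ l) (hl' : IsGerm l') (ht : Tendsto (F.map i) l l')
    (j : Fin (F.numTP + 1)) (m : ℕ) :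
    |PowerSeries.coeff m (F.thetaGerm l' j)| ≤ F.edgeCount i z m := by
  have := hl.neBot
  have hclosed : ∀ᶠ y in l, ∀ g ∈ wordsOfLength n m, y ∈ F.dom (i :: g) → z ∈ F.dom (i :: g) := by
    refine (Finset.eventually_all _).2 fun g _ => ?_
    by_cases hz : z ∈ F.dom (i :: g)
    · exact Eventually.of_forall fun _ _ => hz
    · filter_upwards [hlz ((F.isClosed_dom _).isOpen_compl.mem_nhds hz)] with y hy hy'
        using absurd hy' hy
  obtain ⟨y, ⟨⟨hy, hyI⟩, hyc⟩, hyt⟩ := (((ht.eventually (F.eventually_coeff_theta_eq hl' j m)).and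
    hI).and hclosed |>.and (F.eventually_notMem_turningPoints hl)).exists
  rw [← hy, coeff_theta, edgeCount, Finset.card_filter]
  push_cast
  refine (Finset.abs_sum_le_sum_abs _ _).trans (Finset.sum_le_sum fun g hg => ?_)
  split_ifs with h1 h2 h2
  · have hs : ∀ g, |F.sign g| = 1 := fun g => by
      induction g with
      | nil => simp [sign]
      | cons i g ih =>
        have : F.sign (i :: g) = F.letterSign i * F.sign g := by simp [sign]
        rw [this, abs_mul, ih, abs_letterSign, one_mul]
    rw [abs_mul, hs, one_mul, address]
    split_ifs <;> norm_num
  · exact absurd ⟨(F.nontrivial_dom_cons_iff (F.mem_Ioo_of_mem_I hyt hyI) h1.2).2 h1.1,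
      hyc g hg ⟨hyI, h1.2⟩⟩ h2
  · simp
  · simp

lemma abs_coeff_jump_le (m : ℕ) (z : ℝ) (j : Fin (F.numTP + 1)) :
    |PowerSeries.coeff m (F.jump z j)| ≤ F.lapBdry z m + F.lapBdry z (m + 1) := by
  induction m generalizing z with
  | zero =>
    rw [lapBdry_zero, Nat.cast_zero, zero_add]
    by_cases hz : z ∈ F.turningPoints
    · refine le_trans ?_ (Nat.one_le_cast.2 (F.one_le_lapBdry_one hz))
      obtain ⟨k, hk⟩ := F.eventually_mem_P (isGerm_nhdsGT z)
      obtain ⟨k', hk'⟩ := F.eventually_mem_P (isGerm_nhdsLT z)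
      rw [jump, map_sub, F.coeff_zero_thetaGerm (isGerm_nhdsGT z) hk,
        F.coeff_zero_thetaGerm (isGerm_nhdsLT z) hk']
      split_ifs <;> norm_num
    · rw [F.coeff_zero_jump hz, abs_zero]
      exact Nat.cast_nonneg _
  | succ m ih =>
    obtain ⟨r, hr⟩ := F.exists_isImage (isGerm_nhdsGT z)
    obtain ⟨l, hl⟩ := F.exists_isImage (isGerm_nhdsLT z)
    rw [F.coeff_succ_jump hr hl, lapBdry_succ, lapBdry_succ]
    push_cast
    rw [← Finset.sum_add_distrib]
    refine (Finset.abs_sum_le_sum_abs _ _).trans (Finset.sum_le_sum fun i _ => ?_)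
    have hlt := F.left_lt_right i
    split_ifs with h1 h2 h3 h4 h5 h6
    · exact ih _
    · have hI : F.I i ∈ 𝓝[>] z := F.I_mem_nhdsGT_iff.2 ⟨h2.ge, h2 ▸ hlt⟩
      rw [abs_mul, abs_letterSign, one_mul]
      exact (F.abs_coeff_thetaGerm_le (isGerm_nhdsGT z) nhdsWithin_le_nhds hI (hr i hI).1
        (hr i hI).2 j m).trans (le_add_of_nonneg_right (Nat.cast_nonneg _))
    · exact absurd (show z ∈ F.I i by rw [h2]; exact left_mem_Icc.2 hlt.le) h3
    · have hI : F.I i ∈ 𝓝[<] z := F.I_mem_nhdsLT_iff.2 ⟨h4 ▸ hlt, h4.le⟩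
      rw [abs_neg, abs_mul, abs_letterSign, one_mul]
      exact (F.abs_coeff_thetaGerm_le (isGerm_nhdsLT z) nhdsWithin_le_nhds hI (hl i hI).1
        (hl i hI).2 j m).trans (le_add_of_nonneg_right (Nat.cast_nonneg _))
    · exact absurd (show z ∈ F.I i by rw [h4]; exact right_mem_Icc.2 hlt.le) h5
    · rw [abs_zero]; positivity
    · simp

lemma coeff_hitSeries_nonneg (l : Filter ℝ) (k : Fin F.numTP) (m : ℕ) :
    0 ≤ PowerSeries.coeff m (F.hitSeries l k) := by
  rw [hitSeries, PowerSeries.coeff_mk]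
  exact Finset.sum_nonneg fun _ _ => Nat.cast_nonneg _

lemma coeff_le_coeff_mul {A B : PowerSeries ℚ} (hA : ∀ m, 0 ≤ PowerSeries.coeff m A)
    (hB : ∀ m, 0 ≤ PowerSeries.coeff m B) (h : 1 ≤ PowerSeries.coeff 0 B) (m : ℕ) :
    PowerSeries.coeff m A ≤ PowerSeries.coeff m (A * B) := by
  refine (le_mul_of_one_le_right (hA m) h).trans ?_
  rw [PowerSeries.coeff_mul]
  have hmem : (m, 0) ∈ Finset.HasAntidiagonal.antidiagonal m := by simp
  exact Finset.single_le_sum (f := fun p : ℕ × ℕ =>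
    PowerSeries.coeff p.1 A * PowerSeries.coeff p.2 B)
    (fun p _ => mul_nonneg (hA _) (hB _)) hmem

/-- Appending to a word leading to the turning point `c` a letter whose domain has `c` as an
endpoint gives a word whose domain has the starting point as an endpoint. -/
lemma coeff_hitSeries_le (l : Filter ℝ) (k : Fin F.numTP) (m : ℕ) :
    PowerSeries.coeff m (F.hitSeries l k) ≤ 2 * F.lap (m + 1) := by
  have h1 : PowerSeries.coeff m (F.hitSeries l k) ≤ PowerSeries.coeff m (F.hitSeries atTop k) := by
    rw [hitSeries, hitSeries, PowerSeries.coeff_mk, PowerSeries.coeff_mk]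
    refine Finset.sum_le_sum_of_subset_of_nonneg (fun z hz => ?_) fun _ _ _ => Nat.cast_nonneg _
    exact Finset.mem_filter.2 ⟨(Finset.mem_filter.1 hz).1, Ioi_mem_atTop z⟩
  have h3 := congrArg (PowerSeries.coeff m) F.two_mul_lapSeries
  rw [coeff_two_mul, lapSeries, PowerSeries.coeff_mk] at h3
  rw [h3, map_sum]
  have hb : ∀ k q, 0 ≤ PowerSeries.coeff q (F.bdrySeries k) := fun k q => by
    simp [bdrySeries]
  have hb0 : 1 ≤ PowerSeries.coeff 0 (F.bdrySeries k) := by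
    rw [bdrySeries, PowerSeries.coeff_mk]
    exact_mod_cast F.one_le_lapBdry_one (F.tp_mem k)
  have h4 := coeff_le_coeff_mul (F.coeff_hitSeries_nonneg atTop k) (hb k) hb0 m
  refine h1.trans (h4.trans ?_)
  refine Finset.single_le_sum (f := fun k =>
    PowerSeries.coeff m (F.hitSeries atTop k * F.bdrySeries k)) (fun q _ => ?_)
    (Finset.mem_univ k)
  rw [PowerSeries.coeff_mul]
  exact Finset.sum_nonneg fun p _ => mul_nonneg (F.coeff_hitSeries_nonneg _ _ _) (hb _ _)

end IntervalSystem

/-! ### Convergence, growth and evaluation of power series -/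

namespace PowerSeries

lemma sum_antidiagonal_coeff_mul_pow (A B : PowerSeries ℚ) (t : ℂ) (m : ℕ) :
    ∑ p ∈ Finset.HasAntidiagonal.antidiagonal m,
      (((coeff p.1 A : ℚ) : ℂ) * t ^ p.1) * (((coeff p.2 B : ℚ) : ℂ) * t ^ p.2) =
    ((coeff m (A * B) : ℚ) : ℂ) * t ^ m := by
  rw [coeff_mul]
  push_cast
  rw [Finset.sum_mul]
  refine Finset.sum_congr rfl fun p hp => ?_
  have hm : m = p.1 + p.2 := (Finset.HasAntidiagonal.mem_antidiagonal.1 hp).symm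
  rw [hm, pow_add]
  ring

/-- The subring of the power series converging at `t`. -/
noncomputable def convergentAt (t : ℂ) : Subring (PowerSeries ℚ) where
  carrier := {A | Summable fun m : ℕ => ((coeff m A : ℚ) : ℂ) * t ^ m}
  zero_mem' := by simp [summable_zero]
  one_mem' := by
    rw [mem_ofPred_eq]
    refine summable_of_ne_finset_zero (s := {0}) fun m hm => ?_
    simp [coeff_one, Finset.notMem_singleton.1 hm]
  add_mem' {A B} hA hB := by
    rw [mem_ofPred_eq] at *
    simpa [add_mul] using hA.add hB
  neg_mem' {A} hA := by
    rw [mem_ofPred_eq] at *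
    simpa using hA.neg
  mul_mem' {A B} hA hB := by
    rw [mem_ofPred_eq] at *
    exact (summable_norm_sum_mul_antidiagonal_of_summable_norm hA.norm hB.norm).of_norm.congr
      (sum_antidiagonal_coeff_mul_pow A B t)

lemma mem_convergentAt {A : PowerSeries ℚ} {t : ℂ} :
    A ∈ convergentAt t ↔ Summable fun m : ℕ => ((coeff m A : ℚ) : ℂ) * t ^ m := Iff.rfl

lemma C_mem_convergentAt (c : ℚ) (t : ℂ) : C c ∈ convergentAt t := by
  rw [mem_convergentAt]
  refine summable_of_ne_finset_zero (s := {0}) fun m hm => ?_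
  simp [coeff_C, Finset.notMem_singleton.1 hm]

lemma X_mem_convergentAt (t : ℂ) : X ∈ convergentAt t := by
  rw [mem_convergentAt]
  refine summable_of_ne_finset_zero (s := {1}) fun m hm => ?_
  simp [coeff_X, Finset.notMem_singleton.1 hm]

lemma det_mem_convergentAt {N : ℕ} {M : Matrix (Fin N) (Fin N) (PowerSeries ℚ)} {t : ℂ}
    (h : ∀ i j, M i j ∈ convergentAt t) : M.det ∈ convergentAt t := by
  rw [Matrix.det_apply]
  refine sum_mem fun σ _ => ?_
  rw [Units.smul_def]
  exact zsmul_mem (prod_mem fun i _ => h _ _) _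

lemma adjugate_mem_convergentAt {N : ℕ} {M : Matrix (Fin N) (Fin N) (PowerSeries ℚ)} {t : ℂ}
    (h : ∀ i j, M i j ∈ convergentAt t) (i j : Fin N) : M.adjugate i j ∈ convergentAt t := by
  rw [Matrix.adjugate_apply]
  refine det_mem_convergentAt fun a b => ?_
  rw [Matrix.updateRow_apply, Pi.single_apply]
  split_ifs
  · exact one_mem _
  · exact zero_mem _
  · exact h a b

/-- Comparison with a series with real terms. -/
lemma mem_convergentAt_of_abs_le {A : PowerSeries ℚ} {t : ℂ} {b : ℕ → ℝ}
    (hb : Summable fun m => b m * ‖t‖ ^ m) (h : ∀ m, ((|coeff m A| : ℚ) : ℝ) ≤ b m) :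
    A ∈ convergentAt t := by
  rw [mem_convergentAt]
  refine Summable.of_norm_bounded hb fun m => ?_
  rw [norm_mul, norm_pow]
  refine mul_le_mul_of_nonneg_right ?_ (by positivity)
  refine le_trans (le_of_eq ?_) (h m)
  rw [← Complex.ofReal_ratCast, Complex.norm_real, Real.norm_eq_abs]
  push_cast
  rfl

/-- The sum of a power series at `t` (zero where it does not converge). -/
noncomputable def valueAt (A : PowerSeries ℚ) (t : ℂ) : ℂ :=
  ∑' m : ℕ, ((coeff m A : ℚ) : ℂ) * t ^ m

lemma hasValueAt_valueAt {A : PowerSeries ℚ} {t : ℂ} (hA : A ∈ convergentAt t) :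
    A.HasValueAt t (A.valueAt t) :=
  (mem_convergentAt.1 hA).hasSum

lemma valueAt_mul {A B : PowerSeries ℚ} {t : ℂ} (hA : A ∈ convergentAt t)
    (hB : B ∈ convergentAt t) : (A * B).valueAt t = A.valueAt t * B.valueAt t := by
  have hA' := (mem_convergentAt.1 hA).norm
  have hB' := (mem_convergentAt.1 hB).norm
  rw [valueAt, valueAt, valueAt, tsum_mul_tsum_eq_tsum_sum_antidiagonal_of_summable_norm hA' hB']
  exact tsum_congr fun m => (sum_antidiagonal_coeff_mul_pow A B t m).symm

lemma valueAt_add {A B : PowerSeries ℚ} {t : ℂ} (hA : A ∈ convergentAt t)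
    (hB : B ∈ convergentAt t) : (A + B).valueAt t = A.valueAt t + B.valueAt t := by
  rw [valueAt, valueAt, valueAt, ← Summable.tsum_add (mem_convergentAt.1 hA) (mem_convergentAt.1 hB)]
  simp [add_mul]

lemma valueAt_one (t : ℂ) : (1 : PowerSeries ℚ).valueAt t = 1 := by
  rw [valueAt, tsum_eq_single 0 fun m hm => by simp [coeff_one, hm]]
  simp

lemma analyticAt_valueAt {A : PowerSeries ℚ} {t t' : ℂ} (h : ‖t‖ < ‖t'‖)
    (hA : A ∈ convergentAt t') : AnalyticAt ℂ A.valueAt t := by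
  have hd : DifferentiableOn ℂ A.valueAt (Metric.ball 0 ‖t'‖) := by
    refine Complex.differentiableOn_tsum_of_summable_norm (mem_convergentAt.1 hA).norm
      (fun m => by fun_prop) Metric.isOpen_ball fun m w hw => ?_
    rw [norm_mul, norm_mul, norm_pow, norm_pow]
    gcongr
    exact (mem_ball_zero_iff.1 hw).le
  exact hd.analyticAt (Metric.isOpen_ball.mem_nhds (mem_ball_zero_iff.2 h))

end PowerSeries

lemma exists_gt_mul_lt_one {x c : ℝ} (hc : 0 ≤ c) (h : x * c < 1) : ∃ r, x < r ∧ r * c < 1 := by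
  rcases hc.eq_or_lt with rfl | hc
  · exact ⟨x + 1, by linarith, by simp⟩
  · obtain ⟨r, h1, h2⟩ := exists_between ((lt_div_iff₀ hc).2 h)
    exact ⟨r, h1, (lt_div_iff₀ hc).1 h2⟩

section Growth

variable {a : ℕ → ℕ} {b : ℕ}

lemma eventually_rpow_inv_le (hb : ∀ m, a m ≤ b ^ m) :
    ∀ᶠ m : ℕ in atTop, (a m : ℝ) ^ (1 / (m : ℝ)) ≤ b := by
  filter_upwards [eventually_ne_atTop 0] with m hm
  calc (a m : ℝ) ^ (1 / (m : ℝ)) ≤ ((b : ℝ) ^ m) ^ (1 / (m : ℝ)) :=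
        Real.rpow_le_rpow (Nat.cast_nonneg _) (by exact_mod_cast hb m) (by positivity)
    _ = b := by rw [one_div, Real.pow_rpow_inv_natCast (Nat.cast_nonneg _) hm]

lemma limsup_rpow_inv_le (hb : ∀ m, a m ≤ b ^ m) :
    limsup (fun m : ℕ => (a m : ℝ) ^ (1 / (m : ℝ))) atTop ≤ b :=
  limsup_le_of_le (isCoboundedUnder_le_of_le atTop (x := 0) fun _ => by positivity)
    (eventually_rpow_inv_le hb)

lemma limsup_rpow_inv_nonneg (hb : ∀ m, a m ≤ b ^ m) :
    0 ≤ limsup (fun m : ℕ => (a m : ℝ) ^ (1 / (m : ℝ))) atTop :=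
  le_limsup_of_frequently_le (Frequently.of_forall fun _ => by positivity)
    ⟨b, eventually_map.2 (eventually_rpow_inv_le hb)⟩

/-- The root test. -/
lemma summable_mul_pow_of_limsup (hb : ∀ m, a m ≤ b ^ m) {r : ℝ} (hr : 0 ≤ r)
    (h : r * limsup (fun m : ℕ => (a m : ℝ) ^ (1 / (m : ℝ))) atTop < 1) :
    Summable fun m => (a m : ℝ) * r ^ m := by
  obtain ⟨ρ, hρ, hρr⟩ := exists_gt_mul_lt_one hr (by rwa [mul_comm] at h)
  have hρ0 : 0 ≤ ρ := (limsup_rpow_inv_nonneg hb).trans hρ.le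
  have hev := eventually_lt_of_limsup_lt hρ ⟨(b : ℝ), eventually_map.2 (eventually_rpow_inv_le hb)⟩
  refine Summable.of_norm_bounded_eventually_nat
    (summable_geometric_of_lt_one (mul_nonneg hρ0 hr) hρr) ?_
  filter_upwards [hev, eventually_ne_atTop 0] with m hm hm0
  rw [Real.norm_of_nonneg (by positivity), mul_pow]
  refine mul_le_mul_of_nonneg_right ?_ (by positivity)
  calc (a m : ℝ) = ((a m : ℝ) ^ (1 / (m : ℝ))) ^ m := by
        rw [one_div, Real.rpow_inv_natCast_pow (Nat.cast_nonneg _) hm0]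
    _ ≤ ρ ^ m := pow_le_pow_left₀ (by positivity) hm.le m

lemma summable_succ_mul_pow {f : ℕ → ℝ} {r : ℝ} (h : Summable fun m => f m * r ^ m) :
    Summable fun m => f (m + 1) * r ^ m := by
  by_cases hr : r = 0
  · refine summable_of_ne_finset_zero (s := {0}) fun m hm => ?_
    simp [hr, Finset.notMem_singleton.1 hm]
  · refine (((summable_nat_add_iff 1).2 h).mul_right r⁻¹).congr fun m => ?_
    field_simp
    ring

end Growth

namespace IntervalSystem

variable {n : ℕ} (F : IntervalSystem n)

lemma lap_le (m : ℕ) : F.lap m ≤ n ^ m := by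
  rw [lap, words_eq, ← card_wordsOfLength]
  exact Finset.card_filter_le _ _

lemma lapBdry_le (z : ℝ) (m : ℕ) : F.lapBdry z m ≤ n ^ m :=
  (Finset.card_filter_le _ _).trans (F.lap_le m)

lemma growthBdry_nonneg : 0 ≤ F.growthBdry :=
  Real.iSup_nonneg fun _ => limsup_rpow_inv_nonneg (F.lapBdry_le _)

lemma summable_lapBdry (k : Fin F.numTP) {r : ℝ} (hr : 0 ≤ r) (h : r * F.growthBdry < 1) :
    Summable fun m => (F.lapBdry (F.tp k) m : ℝ) * r ^ m := by
  refine summable_mul_pow_of_limsup (F.lapBdry_le _) hr (lt_of_le_of_lt ?_ h)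
  refine mul_le_mul_of_nonneg_left ?_ hr
  exact le_ciSup (f := fun i : Fin F.numTP =>
    limsup (fun m : ℕ => (F.lapBdry (F.tp i) m : ℝ) ^ (1 / (m : ℝ))) atTop)
    (Set.finite_range _).bddAbove k

lemma summable_lap {r : ℝ} (hr : 0 ≤ r) (h : r * F.growth < 1) :
    Summable fun m => (F.lap m : ℝ) * r ^ m :=
  summable_mul_pow_of_limsup F.lap_le hr h

lemma dom_append_subset (g h : List (Fin n)) : F.dom (g ++ h) ⊆ F.dom g := by
  induction g with
  | nil => exact subset_univ _
  | cons i g ih => exact fun x hx => ⟨hx.1, ih hx.2⟩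

lemma nontrivial_dom_of_append {g h : List (Fin n)} (hn : (F.dom (g ++ h)).Nontrivial) :
    (F.dom h).Nontrivial := by
  induction g with
  | nil => exact hn
  | cons i g ih => exact ih (F.nontrivial_dom_of_cons hn)

lemma lap_add_le (m k : ℕ) : F.lap (m + k) ≤ F.lap m * F.lap k := by
  rw [lap, lap, lap, ← Finset.card_product]
  refine Finset.card_le_card_of_injOn (fun g => (g.take m, g.drop m)) (fun g hg => ?_) ?_
  · obtain ⟨hl, hn⟩ := F.mem_words.1 (Finset.mem_coe.1 hg)
    rw [← List.take_append_drop m g] at hn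
    simp only [Finset.coe_product, mem_prod, Finset.mem_coe, mem_words, List.length_take,
      List.length_drop]
    exact ⟨⟨by omega, hn.mono (F.dom_append_subset _ _)⟩, by omega, F.nontrivial_dom_of_append hn⟩
  · intro g _ g' _ h
    rw [← List.take_append_drop m g, ← List.take_append_drop m g', (Prod.mk.inj h).1,
      (Prod.mk.inj h).2]

lemma lap_pos (h : 0 < F.growth) (m : ℕ) : 0 < F.lap m := by
  by_contra hm
  have hm0 : F.lap m = 0 := Nat.eq_zero_of_not_pos hm
  have hz : ∀ᶠ k : ℕ in atTop, (F.lap k : ℝ) ^ (1 / (k : ℝ)) = 0 := by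
    filter_upwards [eventually_ge_atTop m, eventually_ne_atTop 0] with k hk hk0
    have h1 := F.lap_add_le m (k - m)
    rw [hm0, zero_mul, Nat.add_sub_cancel' hk] at h1
    rw [Nat.le_zero.1 h1, Nat.cast_zero, Real.zero_rpow (by positivity)]
  have : F.growth = 0 := by
    rw [growth, limsup_congr hz, limsup_const]
  exact h.ne' this

/-- Fekete's lemma for the submultiplicative sequence `ℓ`. -/
lemma growth_pow_le_lap (h : 0 < F.growth) (m : ℕ) : F.growth ^ m ≤ F.lap m := by
  have hpos : ∀ k, (0 : ℝ) < F.lap k := fun k => Nat.cast_pos.2 (F.lap_pos h k)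
  have hsub : Subadditive fun k => Real.log (F.lap k) := fun k l => by
    rw [← Real.log_mul (hpos k).ne' (hpos l).ne']
    exact Real.log_le_log (hpos _) (by exact_mod_cast F.lap_add_le k l)
  have hbdd : BddBelow (range fun k : ℕ => Real.log (F.lap k) / k) := by
    refine ⟨0, ?_⟩
    rintro _ ⟨k, rfl⟩
    exact div_nonneg (Real.log_natCast_nonneg _) (Nat.cast_nonneg _)
  have hlim : F.growth = Real.exp hsub.lim := by
    refine Tendsto.limsup_eq (((Real.continuous_exp.tendsto _).comp (hsub.tendsto_lim hbdd)).congr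
      fun k => ?_)
    rw [Function.comp_apply, Real.rpow_def_of_pos (hpos k), mul_one_div]
  rcases Nat.eq_zero_or_pos m with rfl | hm
  · simpa using Nat.one_le_iff_ne_zero.2 (F.lap_pos h 0).ne'
  · have h1 := hsub.lim_le_div hbdd hm.ne'
    rw [le_div_iff₀ (Nat.cast_pos.2 hm)] at h1
    rw [hlim, ← Real.exp_nat_mul, mul_comm, ← Real.exp_log (hpos m)]
    exact Real.exp_le_exp.2 h1

lemma exists_last (h : 0 < F.growth) : ∃ j : Fin F.numTP, ∀ k, k ≤ j := by
  have hn : n ≠ 0 := by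
    rintro rfl
    have := limsup_rpow_inv_le F.lap_le
    rw [Nat.cast_zero] at this
    exact not_lt_of_ge this h
  have hN : 0 < F.numTP :=
    Finset.card_pos.2 ⟨_, F.left_mem_turningPoints ⟨0, Nat.pos_of_ne_zero hn⟩⟩
  exact ⟨⟨F.numTP - 1, by omega⟩, fun k => Fin.le_def.2 (by simp only; omega)⟩

section Convergence

variable {F} {t : ℂ}

lemma bdrySeries_mem_convergentAt (ht : ‖t‖ * F.growthBdry < 1) (k : Fin F.numTP) :
    F.bdrySeries k ∈ PowerSeries.convergentAt t :=
  PowerSeries.mem_convergentAt_of_abs_le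
    (summable_succ_mul_pow (F.summable_lapBdry k (norm_nonneg t) ht)) fun m => by
      simp [bdrySeries]

lemma kneadingMatrix_mem_convergentAt (ht : ‖t‖ * F.growthBdry < 1) (i : Fin F.numTP)
    (j : Fin (F.numTP + 1)) : F.kneadingMatrix i j ∈ PowerSeries.convergentAt t := by
  have h := F.summable_lapBdry i (norm_nonneg t) ht
  refine PowerSeries.mem_convergentAt_of_abs_le
    (b := fun m => (F.lapBdry (F.tp i) m + F.lapBdry (F.tp i) (m + 1) : ℝ))
    ((h.add (summable_succ_mul_pow h)).congr fun m => by ring) fun m => ?_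
  exact_mod_cast F.abs_coeff_jump_le m (F.tp i) j

lemma hitSeries_mem_convergentAt (ht : ‖t‖ * F.growth < 1) (l : Filter ℝ) (k : Fin F.numTP) :
    F.hitSeries l k ∈ PowerSeries.convergentAt t := by
  refine PowerSeries.mem_convergentAt_of_abs_le (b := fun m => 2 * (F.lap (m + 1) : ℝ))
    (((summable_succ_mul_pow (F.summable_lap (norm_nonneg t) ht)).mul_left 2).congr
      fun m => by ring) fun m => ?_
  rw [abs_of_nonneg (F.coeff_hitSeries_nonneg l k m)]
  exact_mod_cast F.coeff_hitSeries_le l k m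

lemma hitMatrix_mem_convergentAt (ht : ‖t‖ * F.growth < 1) (j k : Fin F.numTP) :
    F.hitMatrix j k ∈ PowerSeries.convergentAt t :=
  sub_mem (hitSeries_mem_convergentAt ht _ _) (mul_mem (PowerSeries.X_mem_convergentAt t)
    (sum_mem fun _ _ => mul_mem (PowerSeries.C_mem_convergentAt _ t)
      (hitSeries_mem_convergentAt ht _ _)))

lemma lapSeries_mem_convergentAt (ht : ‖t‖ * F.growth < 1) :
    F.lapSeries ∈ PowerSeries.convergentAt t :=
  PowerSeries.mem_convergentAt_of_abs_le
    (summable_succ_mul_pow (F.summable_lap (norm_nonneg t) ht)) fun m => by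
      simp [lapSeries]

lemma kneadingDet_mem_convergentAt (ht : ‖t‖ * F.growthBdry < 1) :
    F.kneadingDet 0 ∈ PowerSeries.convergentAt t := by
  rw [kneadingDet_zero]
  exact PowerSeries.det_mem_convergentAt fun i j => kneadingMatrix_mem_convergentAt ht i j.succ

end Convergence

/-- The lower bound `s^m ≤ ℓ(m)` bounds `L` from below by a geometric series. -/
lemma growth_div_le_norm_valueAt (h : 0 < F.growth) {x : ℝ} (hx : 0 ≤ x) (hx1 : x * F.growth < 1) :
    F.growth / (1 - x * F.growth) ≤ ‖F.lapSeries.valueAt (x : ℂ)‖ := by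
  have hsum := summable_succ_mul_pow (F.summable_lap hx hx1)
  have hval : F.lapSeries.valueAt (x : ℂ) = ((∑' m, (F.lap (m + 1) : ℝ) * x ^ m : ℝ) : ℂ) := by
    rw [PowerSeries.valueAt, Complex.ofReal_tsum]
    refine tsum_congr fun m => ?_
    simp [lapSeries]
  rw [hval, Complex.norm_real, Real.norm_eq_abs]
  refine le_trans ?_ (le_abs_self _)
  have hg := (hasSum_geometric_of_lt_one (mul_nonneg hx h.le) hx1).mul_left F.growth
  rw [div_eq_mul_inv, ← hg.tsum_eq]
  refine Summable.tsum_le_tsum (fun m => ?_) hg.summable hsum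
  calc F.growth * (x * F.growth) ^ m = F.growth ^ (m + 1) * x ^ m := by ring
    _ ≤ _ := mul_le_mul_of_nonneg_right (F.growth_pow_le_lap h _) (by positivity)

end IntervalSystem

/-! ### Zeros of the kneading determinant and the pole of the lap series -/

theorem theorem4 {n : ℕ} (F : IntervalSystem n) (hs : F.growthBdry < F.growth) :
    (∃ L : ℂ → ℂ,
      MeromorphicOn L {t : ℂ | ‖t‖ * F.growthBdry < 1} ∧
      (∀ t : ℂ, ‖t‖ < 1 / F.growth → F.lapSeries.HasValueAt t (L t)) ∧
      meromorphicOrderAt L ((1 / F.growth : ℝ) : ℂ) < 0) ∧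
    (∃ D : ℂ → ℂ,
      (∀ (j : Fin (F.numTP + 1)) (t : ℂ), ‖t‖ * F.growthBdry < 1 →
        (F.kneadingDet j).HasValueAt t (D t)) ∧
      D ((1 / F.growth : ℝ) : ℂ) = 0 ∧
      ∀ t : ℂ, ‖t‖ < 1 / F.growth → D t ≠ 0) := by
  have hs0 := F.growthBdry_nonneg
  have hpos : 0 < F.growth := hs0.trans_lt hs
  obtain ⟨j, hj⟩ := F.exists_last hpos
  have hsmall : ∀ {t : ℂ}, ‖t‖ < 1 / F.growth → ‖t‖ * F.growth < 1 := fun h =>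
    (lt_div_iff₀ hpos).1 h
  have hlarge : ∀ {t : ℂ}, ‖t‖ * F.growth < 1 → ‖t‖ * F.growthBdry < 1 := fun h =>
    (mul_le_mul_of_nonneg_left hs.le (norm_nonneg _)).trans_lt h
  have hanal : ∀ {A : PowerSeries ℚ},
      (∀ t : ℂ, ‖t‖ * F.growthBdry < 1 → A ∈ PowerSeries.convergentAt t) →
      ∀ t : ℂ, ‖t‖ * F.growthBdry < 1 → AnalyticAt ℂ A.valueAt t := by
    intro A hA t ht
    obtain ⟨r, hr, hr1⟩ := exists_gt_mul_lt_one hs0 ht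
    have hnorm : ‖(r : ℂ)‖ = r := by
      rw [Complex.norm_real, Real.norm_of_nonneg ((norm_nonneg t).trans hr.le)]
    exact PowerSeries.analyticAt_valueAt (t' := (r : ℂ)) (by rwa [hnorm]) (hA _ (by rwa [hnorm]))
  set D : ℂ → ℂ := (F.kneadingDet 0).valueAt with hD
  set M : PowerSeries ℚ := ∑ k,
    (F.kneadingMatrix.submatrix id Fin.succ).adjugate j k * F.bdrySeries k with hM
  have hMmem : ∀ t : ℂ, ‖t‖ * F.growthBdry < 1 → M ∈ PowerSeries.convergentAt t := fun t ht =>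
    sum_mem fun k _ => mul_mem (PowerSeries.adjugate_mem_convergentAt
      (fun i k => IntervalSystem.kneadingMatrix_mem_convergentAt ht i k.succ) j k)
      (IntervalSystem.bdrySeries_mem_convergentAt ht k)
  have hDmem : ∀ t : ℂ, ‖t‖ * F.growthBdry < 1 → F.kneadingDet 0 ∈ PowerSeries.convergentAt t :=
    fun t ht => IntervalSystem.kneadingDet_mem_convergentAt ht
  -- inside the disk of radius `1/s` the inverse of the reduced kneading matrix converges
  have hDne : ∀ t : ℂ, ‖t‖ * F.growth < 1 → D t ≠ 0 := by
    intro t ht h0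
    have h := congrArg (fun A => PowerSeries.valueAt A t) F.kneadingDet_mul_det
    beta_reduce at h
    rw [PowerSeries.valueAt_mul (hDmem t (hlarge ht)) (PowerSeries.det_mem_convergentAt
      (IntervalSystem.hitMatrix_mem_convergentAt ht)), PowerSeries.valueAt_one] at h
    rw [show (F.kneadingDet 0).valueAt t = 0 from h0, zero_mul] at h
    exact zero_ne_one h
  set L : ℂ → ℂ := fun t => M.valueAt t / (2 * D t) with hL
  have hLval : ∀ t : ℂ, ‖t‖ * F.growth < 1 → L t = F.lapSeries.valueAt t := by
    intro t ht
    have hlap := IntervalSystem.lapSeries_mem_convergentAt ht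
    have h := congrArg (fun A => PowerSeries.valueAt A t) (F.kneadingDet_mul_lapSeries hj)
    beta_reduce at h
    rw [two_mul, PowerSeries.valueAt_mul (hDmem t (hlarge ht)) (add_mem hlap hlap),
      PowerSeries.valueAt_add hlap hlap] at h
    rw [hL]
    beta_reduce
    rw [hM, ← h, div_eq_iff (mul_ne_zero two_ne_zero (hDne t ht)), hD]
    ring
  have hmer : MeromorphicOn L {t : ℂ | ‖t‖ * F.growthBdry < 1} := fun t ht =>
    (hanal hMmem t ht).meromorphicAt.div
      ((MeromorphicAt.const 2 t).mul (hanal hDmem t ht).meromorphicAt)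
  have hnorm : ‖((1 / F.growth : ℝ) : ℂ)‖ = 1 / F.growth := by
    rw [Complex.norm_real, Real.norm_of_nonneg (by positivity)]
  have hmem : ‖((1 / F.growth : ℝ) : ℂ)‖ * F.growthBdry < 1 := by
    rw [hnorm, one_div_mul_eq_div, div_lt_one hpos]
    exact hs
  -- `L` tends to infinity along the real axis, hence is not bounded near `1/s`
  have horder : meromorphicOrderAt L ((1 / F.growth : ℝ) : ℂ) < 0 := by
    by_contra! hle
    obtain ⟨c, hc⟩ := tendsto_nhds_of_meromorphicOrderAt_nonneg (hmer _ hmem) hle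
    have hray : Tendsto (fun x : ℝ => (x : ℂ)) (𝓝[<] (1 / F.growth))
        (𝓝[≠] ((1 / F.growth : ℝ) : ℂ)) := by
      refine tendsto_nhdsWithin_iff.2
        ⟨(Complex.continuous_ofReal.tendsto _).mono_left nhdsWithin_le_nhds, ?_⟩
      filter_upwards [self_mem_nhdsWithin] with x hx h
      exact (ne_of_lt hx) (Complex.ofReal_injective h)
    have hlim := (hc.comp hray).norm
    have hinf : Tendsto (fun x : ℝ => F.growth / (1 - x * F.growth)) (𝓝[<] (1 / F.growth))
        atTop := by
      have h0 : Tendsto (fun x : ℝ => 1 - x * F.growth) (𝓝[<] (1 / F.growth)) (𝓝[>] 0) := by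
        refine tendsto_nhdsWithin_iff.2 ⟨?_, ?_⟩
        · have hcont : Continuous fun x : ℝ => 1 - x * F.growth := by fun_prop
          have := hcont.tendsto (1 / F.growth)
          rw [one_div_mul_cancel hpos.ne', sub_self] at this
          exact this.mono_left nhdsWithin_le_nhds
        · filter_upwards [self_mem_nhdsWithin] with x hx
          exact sub_pos.2 ((lt_div_iff₀ hpos).1 hx)
      exact (h0.inv_tendsto_nhdsGT_zero).const_mul_atTop hpos
    refine not_tendsto_nhds_of_tendsto_atTop (tendsto_atTop_mono' _ ?_ hinf) _ hlim
    filter_upwards [Ioo_mem_nhdsLT (one_div_pos.2 hpos)] with x hx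
    have hx1 : x * F.growth < 1 := (lt_div_iff₀ hpos).1 hx.2
    rw [Function.comp_apply, hLval _ (by rwa [Complex.norm_real, Real.norm_of_nonneg hx.1.le])]
    exact F.growth_div_le_norm_valueAt hpos hx.1.le hx1
  refine ⟨⟨L, hmer, fun t ht => ?_, horder⟩, D, fun k t ht => ?_, ?_, fun t ht => hDne t (hsmall ht)⟩
  · rw [hLval t (hsmall ht)]
    exact PowerSeries.hasValueAt_valueAt (IntervalSystem.lapSeries_mem_convergentAt (hsmall ht))
  · rw [F.kneadingDet_eq k]
    exact PowerSeries.hasValueAt_valueAt (hDmem t ht)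
  · -- otherwise the quotient defining `L` would be analytic at `1/s`
    by_contra hne
    exact not_lt_of_ge (((hanal hMmem _ hmem).div (analyticAt_const.mul (hanal hDmem _ hmem))
      (mul_ne_zero two_ne_zero hne)).meromorphicOrderAt_nonneg) horder
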